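/- **Proposition (Denjoy-type inequality).** Let $\alpha\in[0,1]$ and let $T$ be an orientation-preserving diffeomorphism of the circle $\mathbb T^1=\mathbb R/\mathbb Z$ of class $C^{2+\alpha}$ (that is, $C^2$ with $\alpha$-Hölder second derivative; for $\alpha=1$ the second derivative is Lipschitz, and for $\alpha=0$ the class is $C^2$), with irrational rotation number $\rho$. Let $q_n$, $n\ge 0$, be the denominators of the successive convergents $p_n/q_n$ of the continued fraction expansion of $\rho$ (so $q_0=1$). For $\xi\in\mathbb T^1$ and $n\ge 0$ let $\Delta^{(n)}(\xi)$ be the positively oriented arc from $\xi$ to $T^{q_n}\xi$ if $n$ is even, and from $T^{q_n}\xi$ to $\xi$ if $n$ is odd, and let $$l_n=\|T^{q_n}-\mathrm{Id}\|_0=\max_{\xi\in\mathbb T^1}|\Delta^{(n)}(\xi)|\quad(n\ge 0),\qquad l_{-1}=1.$$ Put $$\varepsilon_n=l_{n-1}^{\alpha}+\sum_{j=0}^{n-1}\frac{l_n}{l_j}\,l_{j-1}^{\alpha} =l_{n-1}^{\alpha}+\frac{l_n}{l_{n-1}}l_{n-2}^{\alpha}+\frac{l_n}{l_{n-2}}l_{n-3}^{\alpha}+\dots+\frac{l_n}{l_0}.$$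 Then there is a constant $C$, which may depend on $T$ and $\alpha$ but not on $n$ or $\xi$, such that $$\bigl|(T^{q_n})'(\xi)-1\bigr|\le C\,\varepsilon_n\qquad\text{for all } n\ge 0 \text{ and all } \xi\in\mathbb T^1;$$ that is, $(T^{q_n})'(\xi)=1+\mathcal O(\varepsilon_n)$ uniformly in $\xi$. -/

import Mathlib

open Set Filter Topology

noncomputable section

namespace CircleDynamics

/-- `F` is a (continuous, degree one, nondecreasing) lift to the real line of the map `f` of the
unit circle `ℝ / ℤ`. -/
def IsLift (F : CircleDeg1Lift) (f : UnitAddCircle → UnitAddCircle) : Prop :=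
  Continuous F ∧ ∀ x : ℝ, ((F x : ℝ) : UnitAddCircle) = f (x : UnitAddCircle)

/-- `f` is an orientation-preserving circle diffeomorphism of class `C^{2+α}`: it has a degree one
lift which is `C²` with everywhere positive derivative and whose second derivative is `α`-Hölder
(Lipschitz for `α = 1`, merely continuous for `α = 0`). -/
def IsOrientationPreservingDiffeo (α : ℝ) (f : UnitAddCircle → UnitAddCircle) : Prop :=
  ∃ F : CircleDeg1Lift, IsLift F f ∧ ContDiff ℝ 2 F ∧ (∀ x : ℝ, 0 < deriv F x) ∧
    ∃ K : ℝ, ∀ x y : ℝ, |deriv (deriv F) x - deriv (deriv F) y| ≤ K * |x - y| ^ α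

/-- `ρ` is a rotation number of `f`, i.e. `ρ = lim Fⁱ(x) / i` for some lift `F` of `f`. It is
determined by `f` up to an additive integer. -/
def IsRotationNumber (f : UnitAddCircle → UnitAddCircle) (ρ : ℝ) : Prop :=
  ∃ F : CircleDeg1Lift, IsLift F f ∧ F.translationNumber = ρ

/-- The denominator `q n` of the `n`-th convergent, in lowest terms, of the continued fraction of
`ρ` (so `q 0 = 1`). It depends only on `ρ` modulo `1`. -/
def q (ρ : ℝ) (n : ℕ) : ℕ := (ρ.convergent n).den

/-- The length in `[0, 1)` of the positively oriented arc of the circle from `a` to `b`. -/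
def arcLength (a b : UnitAddCircle) : ℝ := (AddCircle.equivIco (1 : ℝ) 0 (b - a) : ℝ)

/-- The length of the `n`-th fundamental segment at `ξ`, which is the arc `[ξ, f^{q n} ξ]` for even
`n` and the arc `[f^{q n} ξ, ξ]` for odd `n`. -/
def segmentLength (f : UnitAddCircle → UnitAddCircle) (ρ : ℝ) (n : ℕ) (ξ : UnitAddCircle) : ℝ :=
  if Even n then arcLength ξ (f^[q ρ n] ξ) else arcLength (f^[q ρ n] ξ) ξ

/-- `l n`, for `n ≥ 0`: the maximal length of an `n`-th fundamental segment. -/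
def l (f : UnitAddCircle → UnitAddCircle) (ρ : ℝ) (n : ℕ) : ℝ :=
  ⨆ ξ : UnitAddCircle, segmentLength f ρ n ξ

/-- `lPrev n` is `l (n - 1)`, with the convention `l (-1) = 1`. -/
def lPrev (f : UnitAddCircle → UnitAddCircle) (ρ : ℝ) : ℕ → ℝ
  | 0 => 1
  | n + 1 => l f ρ n

/-- `ε n = l_{n-1}^α + (l_n / l_{n-1}) l_{n-2}^α + ⋯ + (l_n / l_1) l_0^α + l_n / l_0`. -/
def ε (α : ℝ) (f : UnitAddCircle → UnitAddCircle) (ρ : ℝ) (n : ℕ) : ℝ :=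
  lPrev f ρ n ^ α + ∑ j ∈ Finset.range n, l f ρ n / l f ρ j * lPrev f ρ j ^ α

/-- The map `f` of the circle has derivative `d` at `ξ`, computed in the coordinates centred at `ξ`
and at `f ξ`, the latter with values in `[-1/2, 1/2)`. -/
def HasCircleDerivAt (f : UnitAddCircle → UnitAddCircle) (d : ℝ) (ξ : UnitAddCircle) : Prop :=
  HasDerivAt (fun t : ℝ =>
    (AddCircle.equivIco (1 : ℝ) (-1 / 2) (f (ξ + (t : UnitAddCircle)) - f ξ) : ℝ)) d 0

end CircleDynamics

end

noncomputable section

/-! The argument runs on a lift `F` with its commuting close returns r_n = F^{q_n} - p_n; write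
d_n(x) = |r_n x - x| for the gaps. Orbits of `F` are ordered as those of the rotation by `ρ`, so by
best approximation the first q_{n+1} images of [x, r_n x] are disjoint on the circle up to endpoints
and have bounded total length. Summing the distortion of `F` over these images gives Denjoy's
inequality |log r_n'| ≤ 12V (`abs_logSlope_q_le`); hence gaps at neighbouring points and levels are
comparable, and d_{n+2} ≤ c/(1+c) d_n.

The refinement uses ratio distortion. For x, y, z in a short interval, the log-ratio of the mean
slopes of `F` over [x,y] and [y,z] is, to first order, F''/(2F') (x - z), which does not involve y.
Therefore the ratio distortion of r_{n+1} relative to [x, r_n x] (`logM`), and that of r_n relative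
to [x, r_{n+1} x] (`logK`), depend on the middle point only up to O(l_n^α) and O(l_{n+1}^α).

Three exact identities then drive an induction on the level. Commutation of returns makes two values
of `logM` sum to two values of `logK` (`logM_add_logM`), so the two quantities nearly agree at each
level. A weighted average of slopes passes from `logM` at level n to `logK` at level n+1 with the
factor d_{n+2}/d_n (`exp_logK_sub_one`). Commutation again relates the relative length changes of
[x, r_n x] under r_{n+1} and of [x, r_{n+1} x] under r_n (`devA_mul_gap`).

The resulting pair of recursions is solved in `add_le_of_recursive_le`, giving the sum ε_n with
d_n(x)/d_j(x) in place of l_n/l_j; `gap_mul_maxGap_le` exchanges the two. Finally r_{n+1}'(x) is the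
mean slope over [x, r_n x] times exp(`logM`), and both factors have been estimated. -/

namespace CircleDynamics

/-! ### Convergents and best approximation. -/

/-- The numerator of the `n`-th convergent of `ρ`. -/
def p (ρ : ℝ) (n : ℕ) : ℤ := (ρ.convergent n).num

/-- The signed distance `q n * ρ - p n`. -/
def θ (ρ : ℝ) (n : ℕ) : ℝ := q ρ n * ρ - p ρ n

theorem q_pos (ρ : ℝ) (n : ℕ) : 0 < q ρ n := (ρ.convergent n).pos

theorem q_zero (ρ : ℝ) : q ρ 0 = 1 := by simp [q]

theorem p_zero (ρ : ℝ) : p ρ 0 = ⌊ρ⌋ := by simp [p]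

theorem irrational_inv_fract {ρ : ℝ} (h : Irrational ρ) : Irrational (Int.fract ρ)⁻¹ :=
  (h.sub_intCast ⌊ρ⌋).inv

theorem fract_pos_of_irrational {ρ : ℝ} (h : Irrational ρ) : 0 < Int.fract ρ :=
  Int.fract_pos.2 fun e => h ⟨⌊ρ⌋, by rw [e]; simp⟩

theorem one_lt_inv_fract {ρ : ℝ} (h : Irrational ρ) : 1 < (Int.fract ρ)⁻¹ :=
  (one_lt_inv₀ (fract_pos_of_irrational h)).2 (Int.fract_lt_one ρ)

theorem convergent_pos {ρ : ℝ} (h : Irrational ρ) (h1 : 1 < ρ) (n : ℕ) :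
    0 < ρ.convergent n := by
  have hf : (1 : ℤ) ≤ ⌊ρ⌋ := Int.le_floor.2 (by exact_mod_cast h1.le)
  have hf' : (1 : ℚ) ≤ ⌊ρ⌋ := by exact_mod_cast hf
  induction n generalizing ρ with
  | zero => simpa using lt_of_lt_of_le one_pos hf
  | succ n ih =>
    have h' := one_lt_inv_fract h
    have hg : (1 : ℤ) ≤ ⌊(Int.fract ρ)⁻¹⌋ := Int.le_floor.2 (by exact_mod_cast h'.le)
    have := ih (irrational_inv_fract h) h' hg (by exact_mod_cast hg)
    rw [Real.convergent_succ]
    have := inv_pos.2 this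
    linarith

theorem p_pos {ρ : ℝ} (h : Irrational ρ) (h1 : 1 < ρ) (n : ℕ) : 0 < p ρ n :=
  Rat.num_pos.2 (convergent_pos h h1 n)

/-- With c = a/b the n-th convergent of 1/{ρ}, the next convergent of ρ is ⌊ρ⌋ + b/a = (⌊ρ⌋a + b)/a,
already in lowest terms, and a > 0. This lets facts about all ρ be proved by induction along the
Gauss map. -/
theorem convergent_succ_num_den {ρ : ℝ} (h : Irrational ρ) (n : ℕ) :
    (q ρ (n + 1) : ℤ) = p (Int.fract ρ)⁻¹ n ∧
      p ρ (n + 1) = ⌊ρ⌋ * p (Int.fract ρ)⁻¹ n + q (Int.fract ρ)⁻¹ n := by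
  have hc := convergent_pos (irrational_inv_fract h) (one_lt_inv_fract h) n
  have hp := p_pos (irrational_inv_fract h) (one_lt_inv_fract h) n
  unfold p q at *
  rw [Real.convergent_succ]
  set c := (Int.fract ρ)⁻¹.convergent n with hcdef
  have e : (⌊ρ⌋ : ℚ) + c⁻¹ = ((⌊ρ⌋ * c.num + c.den : ℤ) : ℚ) / (c.num : ℤ) := by
    have : (c.num : ℚ) ≠ 0 := by exact_mod_cast hp.ne'
    rw [Rat.inv_def]
    rw [Rat.divInt_eq_div]
    push_cast
    field_simp
  have hcop : Nat.Coprime (⌊ρ⌋ * c.num + c.den : ℤ).natAbs (c.num).natAbs := by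
    have := c.reduced
    rw [← Int.isCoprime_iff_nat_coprime]
    have h2 : IsCoprime (c.num) (c.den : ℤ) := by
      rw [Int.isCoprime_iff_nat_coprime]; simpa using this
    have := h2.symm.add_mul_left_left ⌊ρ⌋
    rwa [add_comm, mul_comm] at this
  rw [e]
  exact ⟨Rat.den_div_eq_of_coprime hp hcop, Rat.num_div_eq_of_coprime hp hcop⟩

theorem θ_zero (ρ : ℝ) : θ ρ 0 = Int.fract ρ := by
  simp [θ, q_zero, p_zero]

theorem θ_succ {ρ : ℝ} (h : Irrational ρ) (n : ℕ) :
    θ ρ (n + 1) = -Int.fract ρ * θ (Int.fract ρ)⁻¹ n := by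
  obtain ⟨h1, h2⟩ := convergent_succ_num_den h n
  have h1' : (q ρ (n + 1) : ℝ) = p (Int.fract ρ)⁻¹ n := by exact_mod_cast h1
  have hf := (fract_pos_of_irrational h).ne'
  have hρ : ρ = ⌊ρ⌋ + Int.fract ρ := (Int.floor_add_fract ρ).symm
  unfold θ
  rw [h1', h2]
  push_cast
  rw [mul_sub, mul_left_comm, neg_mul, mul_inv_cancel₀ hf]
  linear_combination (p (Int.fract ρ)⁻¹ n : ℝ) * hρ

theorem θ_sign {ρ : ℝ} (h : Irrational ρ) (n : ℕ) : 0 < (-1) ^ n * θ ρ n := by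
  induction n generalizing ρ with
  | zero => simpa [θ_zero] using fract_pos_of_irrational h
  | succ n ih =>
    have := mul_pos (fract_pos_of_irrational h) (ih (irrational_inv_fract h))
    rw [θ_succ h, pow_succ]
    linarith

theorem abs_θ {ρ : ℝ} (h : Irrational ρ) (n : ℕ) : |θ ρ n| = (-1) ^ n * θ ρ n := by
  rcases neg_one_pow_eq_or ℝ n with e | e <;> have := θ_sign h n <;> rw [e] at this ⊢
  · rw [one_mul] at *; exact abs_of_pos this
  · rw [neg_one_mul] at *; exact abs_of_neg (by linarith)

theorem abs_θ_pos {ρ : ℝ} (h : Irrational ρ) (n : ℕ) : 0 < |θ ρ n| := by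
  rw [abs_θ h]; exact θ_sign h n

theorem abs_θ_succ {ρ : ℝ} (h : Irrational ρ) (n : ℕ) :
    |θ ρ (n + 1)| = Int.fract ρ * |θ (Int.fract ρ)⁻¹ n| := by
  rw [θ_succ h, abs_mul, abs_neg, abs_of_pos (fract_pos_of_irrational h)]

/-- The Gauss map scales all three terms by {ρ}, so only n = 0 matters. There, with f' and f'' the
next two fractional parts, the claim is f'(1 + f'') ≤ 1, true since 1/f' has integer part at least
1. -/
theorem abs_θ_add_le {ρ : ℝ} (h : Irrational ρ) (n : ℕ) :
    |θ ρ (n + 1)| + |θ ρ (n + 2)| ≤ |θ ρ n| := by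
  induction n generalizing ρ with
  | zero =>
    have h' := irrational_inv_fract h
    have hf := fract_pos_of_irrational h
    have hf' := fract_pos_of_irrational h'
    have hf'' := fract_pos_of_irrational (irrational_inv_fract h')
    rw [abs_θ_succ h, abs_θ_succ h, abs_θ_succ h', θ_zero, θ_zero, θ_zero, abs_of_pos hf,
      abs_of_pos hf', abs_of_pos hf'']
    set f := Int.fract ρ
    set f' := Int.fract f⁻¹
    have h1 : (1 : ℤ) ≤ ⌊f'⁻¹⌋ := Int.le_floor.2 (by exact_mod_cast (one_lt_inv_fract h').le)
    have h2 : (1 : ℝ) ≤ ⌊f'⁻¹⌋ := by exact_mod_cast h1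
    have h3 : 1 + Int.fract f'⁻¹ ≤ f'⁻¹ := by
      have := Int.floor_add_fract f'⁻¹
      linarith
    have h4 : f' * (1 + Int.fract f'⁻¹) ≤ 1 := by
      calc _ ≤ f' * f'⁻¹ := by gcongr
        _ = 1 := mul_inv_cancel₀ hf'.ne'
    nlinarith
  | succ n ih =>
    rw [abs_θ_succ h, abs_θ_succ h, abs_θ_succ h, ← mul_add]
    exact mul_le_mul_of_nonneg_left (ih (irrational_inv_fract h)) (fract_pos_of_irrational h).le

theorem abs_θ_succ_lt {ρ : ℝ} (h : Irrational ρ) (n : ℕ) : |θ ρ (n + 1)| < |θ ρ n| := by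
  have := abs_θ_add_le h n
  have := abs_θ_pos h (n + 2)
  linarith

theorem abs_θ_antitone {ρ : ℝ} (h : Irrational ρ) : Antitone fun n => |θ ρ n| :=
  antitone_nat_of_succ_le fun n => (abs_θ_succ_lt h n).le

theorem abs_θ_lt_one {ρ : ℝ} (h : Irrational ρ) (n : ℕ) : |θ ρ n| < 1 := by
  refine (abs_θ_antitone h (Nat.zero_le n)).trans_lt ?_
  simp only [θ_zero]
  rw [abs_of_pos (fract_pos_of_irrational h)]
  exact Int.fract_lt_one ρ

theorem p_mul_q_sub {ρ : ℝ} (h : Irrational ρ) (n : ℕ) :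
    p ρ (n + 1) * q ρ n - p ρ n * q ρ (n + 1) = (-1) ^ n := by
  induction n generalizing ρ with
  | zero =>
    obtain ⟨h1, h2⟩ := convergent_succ_num_den h 0
    rw [h1, h2, q_zero, p_zero, q_zero, p_zero]
    ring
  | succ n ih =>
    obtain ⟨h1, h2⟩ := convergent_succ_num_den h n
    obtain ⟨h3, h4⟩ := convergent_succ_num_den h (n + 1)
    have := ih (irrational_inv_fract h)
    rw [h1, h2, h3, h4, pow_succ, ← this]
    ring

/-- Best approximation property of the convergents. -/
theorem abs_θ_le_abs_mul_sub {ρ : ℝ} (h : Irrational ρ) (n m : ℕ) (k : ℤ) (hm : 0 < m)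
    (hmq : m < q ρ (n + 1)) : |θ ρ n| ≤ |m * ρ - k| := by
  set e : ℤ := (-1) ^ n with he
  have hee : e * e = 1 := by rw [he, ← mul_pow]; simp
  -- Two consecutive convergents form a basis of ℤ² because their determinant is ±1; u and v are the
  -- coordinates of (m, k) by Cramer's rule.
  set u : ℤ := e * (p ρ (n + 1) * m - q ρ (n + 1) * k) with hu
  set v : ℤ := e * (q ρ n * k - p ρ n * m) with hv
  have hdet := p_mul_q_sub h n
  have hm' : (m : ℤ) = u * q ρ n + v * q ρ (n + 1) := by
    rw [hu, hv]
    linear_combination (-(m : ℤ)) * hee - e * m * hdet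
  have hk' : k = u * p ρ n + v * p ρ (n + 1) := by
    rw [hu, hv]
    linear_combination (-k) * hee - e * k * hdet
  have hm'' : (m : ℝ) = u * q ρ n + v * q ρ (n + 1) := by exact_mod_cast hm'
  have key : m * ρ - k = u * θ ρ n + v * θ ρ (n + 1) := by
    rw [hm'', hk']; unfold θ; push_cast; ring
  have hQ := q_pos ρ n
  have hQ' := q_pos ρ (n + 1)
  have hQZ : (0 : ℤ) < q ρ n := by exact_mod_cast hQ
  have hQZ' : (0 : ℤ) < q ρ (n + 1) := by exact_mod_cast hQ'
  have hmZ : (0 : ℤ) < m := by exact_mod_cast hm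
  have hmqZ : (m : ℤ) < q ρ (n + 1) := by exact_mod_cast hmq
  set w : ℝ := (-1) ^ n with hw
  have hww : |w| = 1 := by rw [hw, abs_pow]; simp
  have t0 : w * θ ρ n = |θ ρ n| := (abs_θ h n).symm
  have t1 : w * θ ρ (n + 1) = -|θ ρ (n + 1)| := by rw [abs_θ h (n + 1), pow_succ]; ring
  have p0 := abs_θ_pos h n
  have p1 := abs_θ_pos h (n + 1)
  set A := |θ ρ n|
  set B := |θ ρ (n + 1)|
  have key' : |m * ρ - k| = |u * A - v * B| := by
    rw [← one_mul |m * ρ - k|, ← hww, ← abs_mul, key]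
    congr 1
    linear_combination (u : ℝ) * t0 + (v : ℝ) * t1
  rw [key']
  -- The bounds 0 < m < q_{n+1} exclude u = 0 and keep u and v from having the same sign. As θ_n and
  -- θ_{n+1} have opposite signs, the two contributions add up instead of cancelling.
  rcases lt_trichotomy u 0 with hu0 | hu0 | hu0
  · have hv0 : 0 ≤ v := by by_contra hc; push Not at hc; nlinarith
    have a1 : (u : ℝ) ≤ -1 := by exact_mod_cast (show u ≤ -1 by lia)
    have a2 : (0 : ℝ) ≤ v := by exact_mod_cast hv0
    rw [abs_of_nonpos (by nlinarith)]
    nlinarith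
  · exfalso
    rw [hu0] at hm'
    rcases le_or_gt v 0 with hv0 | hv0 <;> nlinarith
  · have hv0 : v ≤ 0 := by by_contra hc; push Not at hc; nlinarith
    have a1 : (1 : ℝ) ≤ u := by exact_mod_cast (show 1 ≤ u by lia)
    have a2 : (v : ℝ) ≤ 0 := by exact_mod_cast hv0
    rw [abs_of_nonneg (by nlinarith)]
    nlinarith

/-- A drop q_{n+2} < q_{n+1} would make q_{n+2} a competitor in the best approximation property at
level n, contradicting |θ_{n+2}| < |θ_n|. -/
theorem q_le_q_succ {ρ : ℝ} (h : Irrational ρ) (n : ℕ) : q ρ n ≤ q ρ (n + 1) := by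
  cases n with
  | zero => rw [q_zero]; exact q_pos ρ _
  | succ n =>
    by_contra hc
    push Not at hc
    have h1 := abs_θ_le_abs_mul_sub h n (q ρ (n + 2)) (p ρ (n + 2)) (q_pos ρ _) hc
    have h2 := abs_θ_succ_lt h n
    have h3 := abs_θ_succ_lt h (n + 1)
    change |θ ρ n| ≤ |θ ρ (n + 2)| at h1
    linarith

/-! ### Ratio and cross-ratio distortion of a single map. -/

/-- The mean of `deriv F` over the segment from `y` to `x`, i.e. the difference quotient of `F`. -/
def meanDeriv (F : ℝ → ℝ) (x y : ℝ) : ℝ := ∫ t in (0 : ℝ)..1, deriv F (y + t * (x - y))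

section meanDeriv

variable {F : ℝ → ℝ}

theorem continuous_deriv_segment (hF : ContDiff ℝ 2 F) (x y : ℝ) :
    Continuous fun t : ℝ => deriv F (y + t * (x - y)) := by
  have := hF.continuous_deriv (by norm_num)
  fun_prop

theorem meanDeriv_mul (hF : ContDiff ℝ 2 F) (x y : ℝ) :
    meanDeriv F x y * (x - y) = F x - F y := by
  unfold meanDeriv
  rw [← intervalIntegral.integral_mul_const]
  have h : ∀ t ∈ uIcc (0 : ℝ) 1, HasDerivAt (fun t : ℝ => F (y + t * (x - y)))
      (deriv F (y + t * (x - y)) * (x - y)) t := fun t _ => by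
    have h1 : HasDerivAt (fun t : ℝ => y + t * (x - y)) (x - y) t := by
      simpa using ((hasDerivAt_id t).mul_const (x - y)).const_add y
    exact HasDerivAt.comp t (hF.differentiable (by norm_num) _).hasDerivAt h1
  rw [intervalIntegral.integral_eq_sub_of_hasDerivAt h
    (((continuous_deriv_segment hF x y).mul continuous_const).intervalIntegrable _ _)]
  simp

theorem meanDeriv_self (x : ℝ) : meanDeriv F x x = deriv F x := by
  simp [meanDeriv]

theorem meanDeriv_comm (hF : ContDiff ℝ 2 F) (x y : ℝ) : meanDeriv F x y = meanDeriv F y x := by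
  rcases eq_or_ne x y with rfl | h
  · rfl
  · refine mul_right_cancel₀ (sub_ne_zero.2 h) ?_
    linear_combination meanDeriv_mul hF x y + meanDeriv_mul hF y x

theorem le_meanDeriv (hF : ContDiff ℝ 2 F) {m : ℝ} (hm : ∀ x, m ≤ deriv F x) (x y : ℝ) :
    m ≤ meanDeriv F x y := by
  have := intervalIntegral.integral_mono_on (μ := MeasureTheory.volume) zero_le_one
    (continuous_const.intervalIntegrable 0 1)
    ((continuous_deriv_segment hF x y).intervalIntegrable _ _)
    (fun t _ => hm (y + t * (x - y)))
  simpa [meanDeriv] using this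

theorem meanDeriv_pos (hF : ContDiff ℝ 2 F) (h0 : ∀ x, 0 < deriv F x) (x y : ℝ) :
    0 < meanDeriv F x y :=
  intervalIntegral.intervalIntegral_pos_of_pos
    ((continuous_deriv_segment hF x y).intervalIntegrable _ _) (fun _ => h0 _) one_pos

/-- Moving one endpoint by x - z moves the point at parameter t by t(x - z), so a slope A of `deriv
F` is averaged to A ∫ t dt = A/2. The slope does not depend on the other endpoint y, which is what
the cross-ratio bound exploits. -/
theorem abs_meanDeriv_sub_le (hF : ContDiff ℝ 2 F) {s : Set ℝ} (hs : Convex ℝ s) {A E : ℝ}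
    (h : ∀ u ∈ s, ∀ v ∈ s, |deriv F u - deriv F v - A * (u - v)| ≤ E * |u - v|) {x z y : ℝ}
    (hx : x ∈ s) (hz : z ∈ s) (hy : y ∈ s) :
    |meanDeriv F x y - meanDeriv F z y - A / 2 * (x - z)| ≤ E * |x - z| := by
  have hE : 0 ≤ E * |x - z| := (abs_nonneg _).trans (h x hx z hz)
  have e : meanDeriv F x y - meanDeriv F z y - A / 2 * (x - z) =
      ∫ t in (0 : ℝ)..1, (deriv F (y + t * (x - y)) - deriv F (y + t * (z - y)) -
        A * (x - z) * t) := by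
    rw [intervalIntegral.integral_sub, intervalIntegral.integral_sub,
      intervalIntegral.integral_const_mul, integral_id]
    · unfold meanDeriv; ring
    · exact (continuous_deriv_segment hF x y).intervalIntegrable _ _
    · exact (continuous_deriv_segment hF z y).intervalIntegrable _ _
    · exact ((continuous_deriv_segment hF x y).sub
        (continuous_deriv_segment hF z y)).intervalIntegrable _ _
    · exact (continuous_const.mul continuous_id).intervalIntegrable _ _
  rw [e]
  have := intervalIntegral.norm_integral_le_of_norm_le_const (a := (0 : ℝ)) (b := 1)
    (C := E * |x - z|) (f := fun t => deriv F (y + t * (x - y)) - deriv F (y + t * (z - y)) -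
        A * (x - z) * t) fun t ht => by
      rw [uIoc_of_le zero_le_one] at ht
      have hmem : ∀ w ∈ s, y + t * (w - y) ∈ s := fun w hw => by
        have := hs hy hw (by linarith [ht.2] : (0 : ℝ) ≤ 1 - t) ht.1.le (by ring)
        simp only [smul_eq_mul] at this
        convert this using 1; ring
      have h1 := h _ (hmem x hx) _ (hmem z hz)
      have h2 : y + t * (x - y) - (y + t * (z - y)) = (x - z) * t := by ring
      rw [h2, ← mul_assoc, abs_mul, abs_of_pos ht.1, ← mul_assoc] at h1
      exact h1.trans (mul_le_of_le_one_right hE ht.2)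
  simpa using this

theorem abs_log_sub_log_sub_le {m E f a b : ℝ} (hm : 0 < m) (hf : m ≤ f) (ha : m ≤ a) (hb : m ≤ b)
    (haf : |a - f| ≤ E) (hbf : |b - f| ≤ E) :
    |Real.log a - Real.log b - (a - b) / f| ≤ E / m ^ 2 * |a - b| := by
  have hf0 : 0 < f := hm.trans_le hf
  have key := Convex.norm_image_sub_le_of_norm_hasDerivWithin_le
    (f := fun t => Real.log t - t / f) (f' := fun t => t⁻¹ - 1 / f) (s := uIcc b a)
    (C := E / m ^ 2) (x := b) (y := a) (fun t ht => by
      have ht0 : 0 < t := hm.trans_le ((le_inf hb ha).trans ht.1)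
      exact (((Real.hasDerivAt_log ht0.ne').sub
        ((hasDerivAt_id t).div_const f))).hasDerivWithinAt)
    (fun t ht => by
      have htm : m ≤ t := (le_inf hb ha).trans ht.1
      have ht0 : 0 < t := hm.trans_le htm
      have htf : |t - f| ≤ E := by
        rw [abs_le] at *
        rcases le_total b a with hab | hab
        · rw [uIcc_of_le hab] at ht
          exact ⟨by linarith [ht.1], by linarith [ht.2]⟩
        · rw [uIcc_of_ge hab] at ht
          exact ⟨by linarith [ht.1], by linarith [ht.2]⟩
      have e : t⁻¹ - 1 / f = -(t - f) / (t * f) := by field_simp; ring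
      rw [e, Real.norm_eq_abs, abs_div, abs_neg, abs_of_pos (mul_pos ht0 hf0)]
      refine div_le_div₀ ((abs_nonneg _).trans htf) htf (by positivity) ?_
      rw [sq]; exact mul_le_mul htm hf hm.le ht0.le)
    (convex_uIcc b a) left_mem_uIcc right_mem_uIcc
  simp only [Real.norm_eq_abs] at key
  convert key using 2
  ring

theorem abs_log_sub_log_le {m a b : ℝ} (hm : 0 < m) (ha : m ≤ a) (hb : m ≤ b) :
    |Real.log a - Real.log b| ≤ |a - b| / m := by
  have key := Convex.norm_image_sub_le_of_norm_hasDerivWithin_le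
    (f := Real.log) (f' := fun t => t⁻¹) (s := Ici m)
    (C := m⁻¹) (x := b) (y := a)
    (fun t ht => (Real.hasDerivAt_log (hm.trans_le ht).ne').hasDerivWithinAt)
    (fun t ht => by
      have ht0 : 0 < t := hm.trans_le ht
      rw [norm_inv, Real.norm_eq_abs, abs_of_pos ht0]
      exact inv_anti₀ hm ht)
    (convex_Ici m) hb ha
  rw [div_eq_inv_mul]
  simpa using key

end meanDeriv

/-- Bounds, with constant `V`, for the ratio distortion and for the cross-ratio distortion of `F`. -/
structure DistortionBound (F : ℝ → ℝ) (α V : ℝ) : Prop where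
  ratio : ∀ x y z, |Real.log (meanDeriv F x y) - Real.log (meanDeriv F y z)| ≤ V * |x - z|
  cross : ∀ a b x z y y', |a - b| ≤ 1 → x ∈ uIcc a b → z ∈ uIcc a b → y ∈ uIcc a b →
    y' ∈ uIcc a b →
    |(Real.log (meanDeriv F x y) - Real.log (meanDeriv F y z)) -
      (Real.log (meanDeriv F x y') - Real.log (meanDeriv F y' z))| ≤ V * |x - z| * |a - b| ^ α

theorem DistortionBound.nonneg {F : ℝ → ℝ} {α V : ℝ} (h : DistortionBound F α V) : 0 ≤ V := by
  have := (abs_nonneg _).trans (h.ratio 1 0 0)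
  simpa using this

theorem exists_forall_le_of_periodic {g : ℝ → ℝ} (hg : Continuous g)
    (hp : Function.Periodic g 1) : ∃ a, ∀ x, g a ≤ g x := by
  obtain ⟨a, -, ha⟩ := isCompact_Icc.exists_isMinOn (nonempty_Icc.2 (zero_le_one' ℝ))
    hg.continuousOn
  refine ⟨a, fun x => ?_⟩
  obtain ⟨y, hy, hxy⟩ := hp.exists_mem_Ico₀ one_pos x
  rw [hxy]
  exact ha (Ico_subset_Icc_self hy)

theorem periodic_deriv_of_map_add_one {F : ℝ → ℝ} {c : ℝ} (h : ∀ x, F (x + 1) = F x + c) :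
    Function.Periodic (deriv F) 1 := fun x => by
  rw [← deriv_comp_add_const]
  simp only [h, deriv_add_const]

theorem abs_deriv_sub_sub_le {F : ℝ → ℝ} (hF : ContDiff ℝ 2 F) {s : Set ℝ} (hs : Convex ℝ s)
    {A E : ℝ} (h : ∀ w ∈ s, |deriv (deriv F) w - A| ≤ E) {u v : ℝ} (hu : u ∈ s) (hv : v ∈ s) :
    |deriv F u - deriv F v - A * (u - v)| ≤ E * |u - v| := by
  have hd : Differentiable ℝ (deriv F) := by
    have : ContDiff ℝ 1 (deriv F) := ((contDiff_succ_iff_deriv (n := 1)).1 hF).2.2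
    exact this.differentiable (by norm_num)
  have key := Convex.norm_image_sub_le_of_norm_hasDerivWithin_le
    (f := fun t => deriv F t - A * t) (f' := fun t => deriv (deriv F) t - A) (s := s)
    (C := E) (x := v) (y := u)
    (fun t ht => by
      have := (hd t).hasDerivAt.sub ((hasDerivAt_id t).const_mul A)
      rw [mul_one] at this
      exact this.hasDerivWithinAt)
    (fun t ht => h t ht) hs hv hu
  simp only [Real.norm_eq_abs] at key
  convert key using 2
  ring

/-- On an interval with endpoints a, b, the log-ratio of mean slopes equals F''(a)/(2F'(a)) (x - z)
up to O(|x - z| |a - b|^α). The main term is the same for every middle point, so it cancels in the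
cross-ratio bound. Periodicity makes the constants uniform. -/
theorem exists_distortionBound {F : ℝ → ℝ} {α : ℝ} (hα : α ∈ Icc (0 : ℝ) 1)
    (hF : ContDiff ℝ 2 F) (h0 : ∀ x, 0 < deriv F x) (h1 : ∀ x, F (x + 1) = F x + 1)
    {K : ℝ} (hK : ∀ x y : ℝ, |deriv (deriv F) x - deriv (deriv F) y| ≤ K * |x - y| ^ α) :
    ∃ V, DistortionBound F α V := by
  have hc' : ContDiff ℝ 1 (deriv F) := ((contDiff_succ_iff_deriv (n := 1)).1 hF).2.2
  have hp' := periodic_deriv_of_map_add_one h1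
  have hp'' := periodic_deriv_of_map_add_one (c := 0) (F := deriv F) (by simpa using hp')
  obtain ⟨a, ha⟩ := exists_forall_le_of_periodic hc'.continuous hp'
  obtain ⟨b, hb⟩ := exists_forall_le_of_periodic (g := fun x => -|deriv (deriv F) x|)
    (hc'.continuous_deriv le_rfl).abs.neg (fun x => by simp only [hp'' x])
  set m := deriv F a
  set S := |deriv (deriv F) b|
  have hm : 0 < m := h0 a
  have hS : ∀ x, |deriv (deriv F) x| ≤ S := fun x => by
    simpa using hb x
  have hS0 : 0 ≤ S := abs_nonneg _
  have hK0 : 0 ≤ K := by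
    have := (abs_nonneg _).trans (hK 1 0)
    simpa using this
  have hlip : ∀ x z y, |meanDeriv F x y - meanDeriv F z y| ≤ S * |x - z| := fun x z y => by
    have := abs_meanDeriv_sub_le hF (A := 0) (E := S) convex_univ
      (fun u _ v _ => abs_deriv_sub_sub_le hF convex_univ (fun w _ => by simpa using hS w)
        (mem_univ u) (mem_univ v)) (mem_univ x) (mem_univ z) (mem_univ y)
    simpa using this
  have hmD := le_meanDeriv hF ha
  -- the first order expansion of the ratio distortion
  set C := K / m + 2 * S ^ 2 / m ^ 2 with hC
  have hC0 : 0 ≤ C := by positivity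
  have hexp : ∀ a b x z y, |a - b| ≤ 1 → x ∈ uIcc a b → z ∈ uIcc a b → y ∈ uIcc a b →
      |Real.log (meanDeriv F x y) - Real.log (meanDeriv F z y) -
        deriv (deriv F) a / 2 * (x - z) / deriv F a| ≤ C * |x - z| * |a - b| ^ α := by
    intro a b x z y hab hx hz hy
    have hdist : ∀ w ∈ uIcc a b, |w - a| ≤ |a - b| := fun w hw => by
      rw [abs_sub_comm a b]; exact abs_sub_left_of_mem_uIcc hw
    -- Linearising the logarithm costs an error of order |a - b|; since |a - b| ≤ 1 and α ≤ 1 it is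
    -- absorbed into the Hölder error.
    have hpow : |a - b| ≤ |a - b| ^ α := by
      rcases (abs_nonneg (a - b)).eq_or_lt with h | h
      · rw [← h]; exact Real.rpow_nonneg le_rfl _
      · simpa using Real.rpow_le_rpow_of_exponent_ge h hab hα.2
    have e1 := abs_meanDeriv_sub_le hF (A := deriv (deriv F) a) (E := K * |a - b| ^ α)
      (convex_uIcc a b)
      (fun u hu v hv => abs_deriv_sub_sub_le hF (convex_uIcc a b) (fun w hw => (hK w a).trans
        (mul_le_mul_of_nonneg_left (Real.rpow_le_rpow (abs_nonneg _) (hdist w hw) hα.1) hK0))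
          hu hv) hx hz hy
    have hfa : ∀ w ∈ uIcc a b, |meanDeriv F w y - deriv F a| ≤ 2 * S * |a - b| := fun w hw => by
      have t1 := hlip w a y
      have t2 := hlip y a a
      rw [meanDeriv_comm hF y a, meanDeriv_self] at t2
      have t3 := abs_sub_le (meanDeriv F w y) (meanDeriv F a y) (deriv F a)
      have t4 := mul_le_mul_of_nonneg_left (hdist w hw) hS0
      have t5 := mul_le_mul_of_nonneg_left (hdist y hy) hS0
      linarith
    have e2 := abs_log_sub_log_sub_le hm (ha a) (hmD x y) (hmD z y) (hfa x hx) (hfa z hz)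
    have e3 : |(meanDeriv F x y - meanDeriv F z y) / deriv F a -
        deriv (deriv F) a / 2 * (x - z) / deriv F a| ≤ K * |a - b| ^ α * |x - z| / m := by
      rw [← sub_div, abs_div, abs_of_pos (h0 a)]
      exact div_le_div₀ (by positivity) e1 hm (ha a)
    have e4 := abs_sub_le (Real.log (meanDeriv F x y) - Real.log (meanDeriv F z y))
      ((meanDeriv F x y - meanDeriv F z y) / deriv F a)
      (deriv (deriv F) a / 2 * (x - z) / deriv F a)
    have e5 : 2 * S * |a - b| / m ^ 2 * |meanDeriv F x y - meanDeriv F z y| ≤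
        2 * S * |a - b| ^ α / m ^ 2 * (S * |x - z|) := by
      gcongr
      exact hlip x z y
    refine e4.trans ((add_le_add (e2.trans e5) e3).trans_eq ?_)
    rw [hC]
    ring
  refine ⟨max (S / m) (2 * C), fun x y z => ?_, fun a b x z y y' hab hx hz hy hy' => ?_⟩
  · rw [meanDeriv_comm hF y z]
    calc _ ≤ |meanDeriv F x y - meanDeriv F z y| / m := abs_log_sub_log_le hm (hmD _ _) (hmD _ _)
      _ ≤ S * |x - z| / m := by gcongr; exact hlip x z y
      _ = S / m * |x - z| := by ring
      _ ≤ _ := by gcongr; exact le_max_left _ _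
  · rw [meanDeriv_comm hF y z, meanDeriv_comm hF y' z]
    have t1 := hexp a b x z y hab hx hz hy
    have t2 := hexp a b x z y' hab hx hz hy'
    calc _ ≤ _ := abs_sub_le _ (deriv (deriv F) a / 2 * (x - z) / deriv F a) _
      _ ≤ 2 * C * |x - z| * |a - b| ^ α := by
        rw [abs_sub_comm (deriv (deriv F) a / 2 * (x - z) / deriv F a)]
        linarith
      _ ≤ _ := by gcongr; exact le_max_right _ _

/-! ### Close returns and the order of orbits. -/

/-- The `n`-th close return `F ^ (q n) x - p n` of `x`, for a lift `F`. -/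
def ret (F : CircleDeg1Lift) (ρ : ℝ) (n : ℕ) (x : ℝ) : ℝ := F^[q ρ n] x - p ρ n

/-- The distance from `x` to its `n`-th close return. -/
def gap (F : CircleDeg1Lift) (ρ : ℝ) (n : ℕ) (x : ℝ) : ℝ := |ret F ρ n x - x|

section order

variable {F : CircleDeg1Lift} {ρ : ℝ}

theorem iterate_add_int (F : CircleDeg1Lift) (s : ℕ) (x : ℝ) (k : ℤ) :
    F^[s] (x + k) = F^[s] x + k := by
  rw [← F.coe_pow]; exact (F ^ s).map_add_int x k

theorem iterate_sub_int (F : CircleDeg1Lift) (s : ℕ) (x : ℝ) (k : ℤ) :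
    F^[s] (x - k) = F^[s] x - k := by
  rw [← F.coe_pow]; exact (F ^ s).map_sub_int x k

theorem ret_add_int (n : ℕ) (x : ℝ) (k : ℤ) : ret F ρ n (x + k) = ret F ρ n x + k := by
  unfold ret; rw [iterate_add_int]; ring

theorem gap_add_int (n : ℕ) (x : ℝ) (k : ℤ) : gap F ρ n (x + k) = gap F ρ n x := by
  unfold gap; rw [ret_add_int]; congr 1; ring

theorem iterate_ret (F : CircleDeg1Lift) (ρ : ℝ) (n s : ℕ) (x : ℝ) :
    F^[s] (ret F ρ n x) = ret F ρ n (F^[s] x) := by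
  unfold ret
  rw [iterate_sub_int, ← Function.iterate_add_apply, ← Function.iterate_add_apply, add_comm]

theorem ret_ret (F : CircleDeg1Lift) (ρ : ℝ) (n m : ℕ) (x : ℝ) :
    ret F ρ n (ret F ρ m x) = F^[q ρ n + q ρ m] x + (-p ρ n - p ρ m : ℤ) := by
  unfold ret
  rw [iterate_sub_int, ← Function.iterate_add_apply]
  push_cast; ring

theorem ret_comm (F : CircleDeg1Lift) (ρ : ℝ) (n m : ℕ) (x : ℝ) :
    ret F ρ n (ret F ρ m x) = ret F ρ m (ret F ρ n x) := by
  rw [ret_ret, ret_ret, add_comm (q ρ n)]; push_cast; ring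

theorem ret_eq (F : CircleDeg1Lift) (ρ : ℝ) (n : ℕ) (x : ℝ) :
    ret F ρ n x = F^[q ρ n] x + (-p ρ n : ℤ) := by
  unfold ret; push_cast; ring

/-- Orbits of a lift are ordered as those of the translation by its translation number. -/
theorem iterate_add_lt_of_lt (hF : F.translationNumber = ρ) {a b : ℕ} {k l : ℤ}
    (h : a * ρ + k < b * ρ + l) (x : ℝ) : F^[a] x + k < F^[b] x + l := by
  -- Cancelling the smaller iterate leaves a comparison of F^c with an integer translation, decided
  -- by its translation number cρ.
  rcases le_total a b with hab | hab
  · obtain ⟨c, rfl⟩ := Nat.exists_eq_add_of_le' hab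
    have h1 : ((k - l : ℤ) : ℝ) < (F ^ c).translationNumber := by
      rw [CircleDeg1Lift.translationNumber_pow, hF]; push_cast at h ⊢; linarith
    have := (F ^ c).lt_map_of_int_lt_translationNumber h1 (F^[a] x)
    rw [F.coe_pow, ← Function.iterate_add_apply] at this
    push_cast at this; linarith
  · obtain ⟨c, rfl⟩ := Nat.exists_eq_add_of_le' hab
    have h1 : (F ^ c).translationNumber < ((l - k : ℤ) : ℝ) := by
      rw [CircleDeg1Lift.translationNumber_pow, hF]; push_cast at h ⊢; linarith
    have := (F ^ c).map_lt_of_translationNumber_lt_int h1 (F^[b] x)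
    rw [F.coe_pow, ← Function.iterate_add_apply] at this
    push_cast at this; linarith

theorem iterate_add_le_of_le (hF : F.translationNumber = ρ) (hρ : Irrational ρ) {a b : ℕ}
    {k l : ℤ} (h : a * ρ + k ≤ b * ρ + l) (x : ℝ) : F^[a] x + k ≤ F^[b] x + l := by
  rcases h.lt_or_eq with h | h
  · exact (iterate_add_lt_of_lt hF h x).le
  · have hab : (a : ℤ) - b = 0 := by
      by_contra hc
      refine (hρ.intCast_mul hc).ne_int (l - k) ?_
      push_cast; linarith
    have hab' : a = b := by lia
    subst hab'
    have : (k : ℝ) = l := by linarith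
    rw [this]

theorem iterate_mem_uIcc (hF : F.translationNumber = ρ) (hρ : Irrational ρ) {a b c : ℕ}
    {k l m : ℤ} (h : a * ρ + k ∈ uIcc (b * ρ + l) (c * ρ + m)) (x : ℝ) :
    F^[a] x + k ∈ uIcc (F^[b] x + l) (F^[c] x + m) := by
  rw [mem_uIcc] at h ⊢
  exact h.imp (And.imp (fun h => iterate_add_le_of_le hF hρ h x)
    (fun h => iterate_add_le_of_le hF hρ h x))
    (And.imp (fun h => iterate_add_le_of_le hF hρ h x) (fun h => iterate_add_le_of_le hF hρ h x))

theorem iterate_mem_uIcc_self (hF : F.translationNumber = ρ) (hρ : Irrational ρ) {a c : ℕ}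
    {k m : ℤ} (h : a * ρ + k ∈ uIcc 0 (c * ρ + m)) (x : ℝ) :
    F^[a] x + k ∈ uIcc x (F^[c] x + m) := by
  have := iterate_mem_uIcc hF hρ (b := 0) (l := 0) (a := a) (c := c) (k := k) (m := m)
    (by simpa using h) x
  simpa using this

theorem θ_mem_uIcc_of_mul_nonneg {a b : ℝ} (h : 0 ≤ a * b) (hab : |a| ≤ |b|) : a ∈ uIcc 0 b := by
  rcases le_total 0 b with hb | hb
  · rw [uIcc_of_le hb]
    rw [abs_of_nonneg hb] at hab
    rcases hb.eq_or_lt with rfl | hb'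
    · simp at hab; simp [hab]
    · exact ⟨nonneg_of_mul_nonneg_left h hb', (le_abs_self a).trans hab⟩
  · rw [uIcc_of_ge hb]
    rw [abs_of_nonpos hb] at hab
    rcases hb.eq_or_lt with rfl | hb'
    · simp at hab; simp [hab]
    · exact ⟨by linarith [neg_abs_le a], by nlinarith⟩

theorem θ_mem_uIcc (hρ : Irrational ρ) (n k : ℕ) : θ ρ (n + 2 * k) ∈ uIcc 0 (θ ρ n) := by
  refine θ_mem_uIcc_of_mul_nonneg ?_ (abs_θ_antitone hρ (Nat.le_add_right n (2 * k)))
  have h1 := θ_sign hρ n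
  have h2 := θ_sign hρ (n + 2 * k)
  rw [pow_add, pow_mul, neg_one_sq, one_pow, mul_one] at h2
  rcases neg_one_pow_eq_or ℝ n with e | e <;> rw [e] at h1 h2 <;> nlinarith

theorem θ_add_mem_uIcc (hρ : Irrational ρ) (n : ℕ) :
    θ ρ n + θ ρ (n + 1) ∈ uIcc 0 (θ ρ n) := by
  have h1 := abs_θ_succ_lt hρ n
  rw [abs_θ hρ, abs_θ hρ, pow_succ] at h1
  have h3 := θ_sign hρ n
  have h4 := θ_sign hρ (n + 1)
  rw [pow_succ] at h4
  rw [mem_uIcc]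
  rcases neg_one_pow_eq_or ℝ n with e | e <;> rw [e] at h1 h3 h4
  · left; constructor <;> linarith
  · right; constructor <;> linarith

theorem ret_mem_uIcc_ret (hF : F.translationNumber = ρ) (hρ : Irrational ρ) (n k : ℕ) (x : ℝ) :
    ret F ρ (n + 2 * k) x ∈ uIcc x (ret F ρ n x) := by
  rw [ret_eq, ret_eq]
  refine iterate_mem_uIcc_self hF hρ ?_ x
  have := θ_mem_uIcc hρ n k
  unfold θ at this
  push_cast
  simpa only [sub_eq_add_neg] using this

theorem ret_succ_ret_mem_uIcc (hF : F.translationNumber = ρ) (hρ : Irrational ρ) (n : ℕ) (x : ℝ) :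
    ret F ρ (n + 1) (ret F ρ n x) ∈ uIcc x (ret F ρ n x) := by
  rw [ret_ret, ret_eq]
  refine iterate_mem_uIcc_self hF hρ ?_ x
  convert θ_add_mem_uIcc hρ n using 1
  · simp [θ, sub_eq_add_neg]
  · unfold θ; push_cast; ring

/-- For the rotation this is 2|θ_{n+2}| ≤ |θ_{n+1}| + |θ_{n+2}| ≤ |θ_n| with equal signs. That two
consecutive segments of level n+2 fit into one of level n is the source of the contraction
`gap_contract`. -/
theorem ret_ret_mem_uIcc (hF : F.translationNumber = ρ) (hρ : Irrational ρ) (n : ℕ) (x : ℝ) :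
    ret F ρ (n + 2) (ret F ρ (n + 2) x) ∈ uIcc x (ret F ρ n x) := by
  rw [ret_ret, ret_eq]
  refine iterate_mem_uIcc_self hF hρ ?_ x
  have h1 := abs_θ_add_le hρ n
  have h2 := abs_θ_succ_lt hρ (n + 1)
  have h3 : 0 ≤ (θ ρ (n + 2) + θ ρ (n + 2)) * θ ρ n := by
    have h1 := θ_sign hρ n
    have h2 := θ_sign hρ (n + 2)
    rw [pow_add, neg_one_sq, mul_one] at h2
    rcases neg_one_pow_eq_or ℝ n with e | e <;> rw [e] at h1 h2 <;> nlinarith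
  have h4 : |θ ρ (n + 2) + θ ρ (n + 2)| ≤ |θ ρ n| := (abs_add_le _ _).trans (by linarith)
  convert θ_mem_uIcc_of_mul_nonneg h3 h4 using 1
  · simp [θ, sub_eq_add_neg]
  · unfold θ; push_cast; ring

theorem gap_eq (hF : F.translationNumber = ρ) (hρ : Irrational ρ) (n : ℕ) (x : ℝ) :
    gap F ρ n x = (-1) ^ n * (ret F ρ n x - x) ∧ 0 < gap F ρ n x := by
  have h := θ_sign hρ n
  unfold gap
  rw [ret_eq]
  rcases neg_one_pow_eq_or ℝ n with e | e <;> rw [e] at h ⊢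
  · have := iterate_add_lt_of_lt hF (a := 0) (k := 0) (b := q ρ n) (l := -p ρ n)
      (by unfold θ at h; push_cast; linarith) x
    simp only [Function.iterate_zero, id, Int.cast_zero, add_zero] at this
    rw [abs_of_pos (by linarith)]
    constructor <;> linarith
  · have := iterate_add_lt_of_lt hF (b := 0) (l := 0) (a := q ρ n) (k := -p ρ n)
      (by unfold θ at h; push_cast; linarith) x
    simp only [Function.iterate_zero, id, Int.cast_zero, add_zero] at this
    rw [abs_of_neg (by linarith)]
    constructor <;> linarith

theorem gap_pos (hF : F.translationNumber = ρ) (hρ : Irrational ρ) (n : ℕ) (x : ℝ) :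
    0 < gap F ρ n x := (gap_eq hF hρ n x).2

theorem gap_lt_one (hF : F.translationNumber = ρ) (hρ : Irrational ρ) (n : ℕ) (x : ℝ) :
    gap F ρ n x < 1 := by
  have h := abs_lt.1 (abs_θ_lt_one hρ n)
  unfold gap
  rw [ret_eq]
  unfold θ at h
  have h1 := iterate_add_lt_of_lt hF (a := 0) (k := -1) (b := q ρ n) (l := -p ρ n)
      (by push_cast; linarith) x
  have h2 := iterate_add_lt_of_lt hF (b := 0) (l := 1) (a := q ρ n) (k := -p ρ n)
      (by push_cast; linarith) x
  simp only [Function.iterate_zero, id] at h1 h2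
  rw [abs_lt]
  push_cast at *
  constructor <;> linarith

theorem abs_iterate_sub_iterate_ret (n s : ℕ) (x : ℝ) :
    |F^[s] x - F^[s] (ret F ρ n x)| = gap F ρ n (F^[s] x) := by
  rw [iterate_ret, gap, abs_sub_comm]

theorem gap_add_two_le (hF : F.translationNumber = ρ) (hρ : Irrational ρ) (n : ℕ) (x : ℝ) :
    gap F ρ (n + 2) x ≤ gap F ρ n x :=
  abs_sub_left_of_mem_uIcc (ret_mem_uIcc_ret hF hρ n 1 x)

theorem sum_sub_le_of_disjoint {ι : Type*} (s : Finset ι) (a b : ι → ℝ) {A B : ℝ} (hAB : A ≤ B)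
    (ha : ∀ i ∈ s, a i ∈ Icc A B) (hb : ∀ i ∈ s, b i ∈ Icc A B)
    (hd : ∀ i ∈ s, ∀ j ∈ s, i ≠ j → max (a i) (b i) ≤ min (a j) (b j) ∨
      max (a j) (b j) ≤ min (a i) (b i)) : ∑ i ∈ s, |a i - b i| ≤ B - A := by
  have h1 : MeasureTheory.volume (⋃ i ∈ s, Ioo (min (a i) (b i)) (max (a i) (b i))) =
      ∑ i ∈ s, MeasureTheory.volume (Ioo (min (a i) (b i)) (max (a i) (b i))) := by
    refine MeasureTheory.measure_biUnion_finset (fun i hi j hj hij => ?_)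
      (fun i _ => measurableSet_Ioo)
    refine Set.disjoint_left.2 fun t ht ht' => ?_
    rcases hd i hi j hj hij with h | h
    · exact (ht.2.trans_le (h.trans ht'.1.le)).false
    · exact (ht'.2.trans_le (h.trans ht.1.le)).false
  have h2 : MeasureTheory.volume (⋃ i ∈ s, Ioo (min (a i) (b i)) (max (a i) (b i))) ≤
      MeasureTheory.volume (Icc A B) := by
    refine MeasureTheory.measure_mono (iUnion₂_subset fun i hi t ht => ?_)
    exact ⟨(le_min (ha i hi).1 (hb i hi).1).trans ht.1.le,
      ht.2.le.trans (max_le (ha i hi).2 (hb i hi).2)⟩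
  rw [h1, Real.volume_Icc] at h2
  simp only [Real.volume_Ioo] at h2
  rw [← ENNReal.ofReal_sum_of_nonneg (fun i _ => by simp)] at h2
  refine le_trans (le_of_eq (Finset.sum_congr rfl fun i _ => ?_))
    ((ENNReal.ofReal_le_ofReal_iff (by linarith)).1 h2)
  rw [max_sub_min_eq_abs']

/-- The segments from `F^s x` to its `n`-th close return, `s < q (n + 1)`, are disjoint. -/
theorem sum_gap_le (hF : F.translationNumber = ρ) (hρ : Irrational ρ) (n : ℕ) (x : ℝ) :
    ∑ s ∈ Finset.range (q ρ (n + 1)), gap F ρ n (F^[s] x) ≤ 3 := by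
  -- Integer shifts bring the base points into [0, 1). As gaps are below 1, all segments then lie in
  -- [-1, 2], whence the bound 3.
  set k : ℕ → ℤ := fun s => -⌊F^[s] x⌋ with hk
  set a : ℕ → ℝ := fun s => F^[s] x + k s with ha
  set b : ℕ → ℝ := fun s => F^[s + q ρ n] x + (k s - p ρ n : ℤ) with hb
  have hab : ∀ s, b s - a s = ret F ρ n (F^[s] x) - F^[s] x := fun s => by
    simp only [ha, hb, ret, ← Function.iterate_add_apply, add_comm s]
    push_cast; ring
  have hab' : ∀ s, gap F ρ n (F^[s] x) = |a s - b s| := fun s => by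
    rw [abs_sub_comm, hab, gap]
  have ha01 : ∀ s, a s ∈ Ico (0 : ℝ) 1 := fun s => by
    have h1 := Int.floor_le (F^[s] x)
    have h2 := Int.lt_floor_add_one (F^[s] x)
    simp only [ha, hk]
    push_cast
    constructor <;> linarith
  have hlt : ∀ s, |a s - b s| < 1 := fun s => by rw [← hab']; exact gap_lt_one hF hρ n _
  rw [Finset.sum_congr rfl fun s _ => hab' s]
  refine (sum_sub_le_of_disjoint (A := -1) (B := 2) _ a b (by norm_num) (fun s _ => ?_)
    (fun s _ => ?_) ?_).trans (by norm_num)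
  · have := ha01 s
    exact ⟨by linarith [this.1], by linarith [this.2]⟩
  · have := ha01 s
    have h2 := abs_lt.1 (hlt s)
    exact ⟨by linarith [this.1, h2.1, h2.2], by linarith [this.2, h2.1, h2.2]⟩
  have main : ∀ s t, |θ ρ n| ≤ t * ρ + k t - (s * ρ + k s) → max (a s) (b s) ≤ min (a t) (b t) := by
    intro s t h
    have h0 := neg_abs_le (θ ρ n)
    have h1 := le_abs_self (θ ρ n)
    have h2 := abs_nonneg (θ ρ n)
    have h3 := abs_θ hρ n
    unfold θ at h0 h1 h3
    have h4 : q ρ n * ρ - p ρ n = |q ρ n * ρ - p ρ n| ∨ q ρ n * ρ - p ρ n = -|q ρ n * ρ - p ρ n| := by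
      rcases le_total 0 (q ρ n * ρ - p ρ n) with h | h
      · left; rw [abs_of_nonneg h]
      · right; rw [abs_of_nonpos h]; ring
    unfold θ at h h2
    refine max_le (le_min ?_ ?_) (le_min ?_ ?_) <;>
    · refine iterate_add_le_of_le hF hρ ?_ x
      push_cast
      rcases h4 with h4 | h4 <;> linarith
  -- Best approximation with m = t - s < q_{n+1}: for the rotation, distinct base points are at
  -- least one segment length |θ_n| apart.
  have sep : ∀ s t, s < t → t < q ρ (n + 1) →
      |θ ρ n| ≤ |(t * ρ + k t) - (s * ρ + k s)| := fun s t hst ht => by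
    have := abs_θ_le_abs_mul_sub hρ n (t - s) (k s - k t) (by lia) (by lia)
    rw [Nat.cast_sub hst.le] at this
    push_cast at this
    convert this using 2
    ring
  intro s hs t ht hst
  rw [Finset.mem_range] at hs ht
  have key : |θ ρ n| ≤ |(t * ρ + k t) - (s * ρ + k s)| := by
    rcases lt_or_gt_of_ne hst with h | h
    · exact sep s t h ht
    · rw [abs_sub_comm]; exact sep t s h hs
  rcases le_total 0 ((t * ρ + k t) - (s * ρ + k s)) with h | h
  · left; rw [abs_of_nonneg h] at key; exact main s t key
  · right; rw [abs_of_nonpos h] at key; exact main t s (by linarith)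

/-- The dynamical partition of level `n` covers the circle. -/
theorem exists_mem_partition (hF : F.translationNumber = ρ) (hρ : Irrational ρ) (n : ℕ)
    (x z : ℝ) : ∃ (i : ℕ) (k : ℤ),
      (i < q ρ (n + 1) ∧ z + k ∈ uIcc (F^[i] x) (ret F ρ n (F^[i] x))) ∨
      (i < q ρ n ∧ z + k ∈ uIcc (F^[i] x) (ret F ρ (n + 1) (F^[i] x))) := by
  obtain ⟨σ, hσ⟩ : ∃ σ : ℤ, σ = (-1) ^ n := ⟨_, rfl⟩
  have hσ1 : σ = 1 ∨ σ = -1 := by rw [hσ]; exact neg_one_pow_eq_or ℤ n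
  have hσR : (σ : ℝ) = (-1) ^ n := by rw [hσ]; push_cast; rfl
  -- Among the first q_n + q_{n+1} orbit points modulo 1, take the last one met before z in the
  -- direction σ = (-1)^n. If i < q_{n+1}, then i + q_n is still in range and lies further in that
  -- direction, so it is at or beyond z. Otherwise i = q_{n+1} + j, and j plays this role, since
  -- returns of level n+1 go backwards.
  obtain ⟨i, hi, hmin⟩ := Finset.exists_min_image (Finset.range (q ρ n + q ρ (n + 1)))
    (fun i => Int.fract (σ * (z - F^[i] x))) ⟨0, by simp [q_pos]⟩
  rw [Finset.mem_range] at hi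
  set v := Int.fract (σ * (z - F^[i] x)) with hv
  set k := ⌊σ * (z - F^[i] x)⌋ with hk
  have hvk : v = σ * (z - F^[i] x) - k := rfl
  have hσ1' : (σ : ℝ) = 1 ∨ (σ : ℝ) = -1 := by exact_mod_cast hσ1
  have hv0' : 0 ≤ σ * (z - F^[i] x) - k := Int.fract_nonneg _
  have hv1 : v < 1 := Int.fract_lt_one _
  have next : ∀ (j : ℕ) (l : ℤ), j < q ρ n + q ρ (n + 1) → σ * (z - F^[j] x) - l < v →
      σ * (z - F^[j] x) - l ≤ 0 := fun j l hj hlt => by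
    by_contra hc
    push Not at hc
    have e : Int.fract (σ * (z - F^[j] x)) = σ * (z - F^[j] x) - l := by
      rw [Int.fract_eq_iff]
      exact ⟨hc.le, hlt.trans hv1, l, by ring⟩
    have := hmin j (Finset.mem_range.2 hj)
    linarith
  rcases lt_or_ge i (q ρ (n + 1)) with h | h
  · refine ⟨i, -σ * k, Or.inl ⟨h, ?_⟩⟩
    obtain ⟨g1, g2⟩ := gap_eq hF hρ n (F^[i] x)
    rw [g1, ← hσR] at g2
    have e : (ret F ρ n (F^[i] x)) = F^[q ρ n + i] x - p ρ n := by
      rw [ret, ← Function.iterate_add_apply]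
    rw [e] at g2 ⊢
    have := next (q ρ n + i) (k - σ * p ρ n) (by lia) (by push_cast; linarith)
    rw [mem_uIcc]
    push_cast at this ⊢
    rcases hσ1' with s1 | s1 <;> rw [s1] at hv0' this g2 ⊢
    · left; constructor <;> linarith
    · right; constructor <;> linarith
  · obtain ⟨j, rfl⟩ := Nat.exists_eq_add_of_le h
    refine ⟨j, -σ * k - p ρ (n + 1), Or.inr ⟨by lia, ?_⟩⟩
    obtain ⟨g1, g2⟩ := gap_eq hF hρ (n + 1) (F^[j] x)
    rw [g1, pow_succ, ← hσR] at g2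
    have e : (ret F ρ (n + 1) (F^[j] x)) = F^[q ρ (n + 1) + j] x - p ρ (n + 1) := by
      rw [ret, ← Function.iterate_add_apply]
    rw [e] at g2 ⊢
    have := next j (k + σ * p ρ (n + 1)) (by lia) (by push_cast; linarith)
    rw [mem_uIcc]
    push_cast at this ⊢
    rcases hσ1' with s1 | s1 <;> rw [s1] at hv0' this g2 ⊢
    · right; constructor <;> linarith
    · left; constructor <;> linarith

end order

/-! ### Slopes of iterates and Denjoy's inequality. -/

/-- A `C²` lift of a diffeomorphism, with irrational translation number `ρ` and with distortion
bounds. -/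
structure IrrationalLift (F : CircleDeg1Lift) (ρ α V : ℝ) : Prop where
  contDiff : ContDiff ℝ 2 F
  deriv_pos : ∀ x, 0 < deriv F x
  irrational : Irrational ρ
  translationNumber_eq : F.translationNumber = ρ
  bound : DistortionBound F α V

/-- The logarithm of the difference quotient of the `m`-th iterate of `F` between `x` and `y`. -/
def logSlope (F : ℝ → ℝ) (m : ℕ) (x y : ℝ) : ℝ :=
  ∑ s ∈ Finset.range m, Real.log (meanDeriv F (F^[s] x) (F^[s] y))

section logSlope

variable {F : ℝ → ℝ}

theorem logSlope_comm (hF : ContDiff ℝ 2 F) (m : ℕ) (x y : ℝ) :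
    logSlope F m x y = logSlope F m y x :=
  Finset.sum_congr rfl fun s _ => by rw [meanDeriv_comm hF]

theorem logSlope_add (F : ℝ → ℝ) (a b : ℕ) (x y : ℝ) :
    logSlope F (b + a) x y = logSlope F b x y + logSlope F a (F^[b] x) (F^[b] y) := by
  unfold logSlope
  rw [Finset.sum_range_add]
  simp only [← Function.iterate_add_apply, add_comm b]

theorem logSlope_add_comm (F : ℝ → ℝ) (a b : ℕ) (x y : ℝ) :
    logSlope F b x y + logSlope F a (F^[b] x) (F^[b] y) =
      logSlope F a x y + logSlope F b (F^[a] x) (F^[a] y) := by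
  rw [← logSlope_add, ← logSlope_add, add_comm]

theorem exp_logSlope_mul (hF : ContDiff ℝ 2 F) (h0 : ∀ x, 0 < deriv F x) (m : ℕ) (x y : ℝ) :
    Real.exp (logSlope F m x y) * (x - y) = F^[m] x - F^[m] y := by
  induction m with
  | zero => simp [logSlope]
  | succ m ih =>
    rw [logSlope_add, Real.exp_add, Function.iterate_succ_apply', Function.iterate_succ_apply',
      ← meanDeriv_mul hF, ← ih]
    have : logSlope F 1 (F^[m] x) (F^[m] y) = Real.log (meanDeriv F (F^[m] x) (F^[m] y)) := by
      simp [logSlope]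
    rw [this, Real.exp_log (meanDeriv_pos hF h0 _ _)]
    ring

theorem hasDerivAt_iterate (hF : ContDiff ℝ 2 F) (h0 : ∀ x, 0 < deriv F x) (m : ℕ) (x : ℝ) :
    HasDerivAt F^[m] (Real.exp (logSlope F m x x)) x := by
  induction m with
  | zero => simpa [logSlope] using hasDerivAt_id x
  | succ m ih =>
    rw [logSlope_add, Real.exp_add, Function.iterate_succ']
    have : logSlope F 1 (F^[m] x) (F^[m] x) = Real.log (deriv F (F^[m] x)) := by
      simp [logSlope, meanDeriv_self]
    rw [this, Real.exp_log (h0 _), mul_comm]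
    exact (hF.differentiable (by norm_num) _).hasDerivAt.comp x ih

theorem exists_logSlope_eq (hF : ContDiff ℝ 2 F) (h0 : ∀ x, 0 < deriv F x) (m : ℕ) (x y : ℝ) :
    ∃ c, logSlope F m x y = logSlope F m c c := by
  wlog h : x ≤ y generalizing x y
  · rw [logSlope_comm hF]; exact this y x (le_of_not_ge h)
  rcases h.eq_or_lt with rfl | h
  · exact ⟨x, rfl⟩
  have hd := hasDerivAt_iterate hF h0 m
  obtain ⟨c, -, hc⟩ := exists_hasDerivAt_eq_slope F^[m] _ h
    (fun t _ => (hd t).continuousAt.continuousWithinAt) (fun t _ => hd t)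
  refine ⟨c, Real.exp_injective ?_⟩
  rw [hc, eq_div_iff (sub_pos.2 h).ne']
  linear_combination -exp_logSlope_mul hF h0 m x y

theorem abs_logSlope_sub_le {α V : ℝ} (hV : DistortionBound F α V) (m : ℕ) (u w v : ℝ) :
    |logSlope F m u w - logSlope F m w v| ≤ V * ∑ s ∈ Finset.range m, |F^[s] u - F^[s] v| := by
  unfold logSlope
  rw [← Finset.sum_sub_distrib, Finset.mul_sum]
  exact (Finset.abs_sum_le_sum_abs _ _).trans (Finset.sum_le_sum fun s _ => hV.ratio _ _ _)

theorem meanDeriv_add_int (F : CircleDeg1Lift) (x y : ℝ) (k : ℤ) :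
    meanDeriv F (x + k) (y + k) = meanDeriv F x y := by
  unfold meanDeriv
  congr 1
  ext t
  have e : y + k + t * (x + k - (y + k)) = y + t * (x - y) + k := by ring
  rw [e, ← deriv_comp_add_const]
  simp only [F.map_add_int, deriv_add_const]

theorem logSlope_add_int (F : CircleDeg1Lift) (m : ℕ) (x y : ℝ) (k : ℤ) :
    logSlope F m (x + k) (y + k) = logSlope F m x y := by
  unfold logSlope
  simp only [iterate_add_int, meanDeriv_add_int]

theorem logSlope_ret (F : CircleDeg1Lift) (ρ : ℝ) (n m : ℕ) (x y : ℝ) :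
    logSlope F m (ret F ρ n x) (ret F ρ n y) =
      logSlope F m (F^[q ρ n] x) (F^[q ρ n] y) := by
  rw [ret_eq, ret_eq, logSlope_add_int]

/-- Both sides are the log slope of F^{q_n + q_m}; integer shifts do not affect slopes. -/
theorem logSlope_ret_comm (F : CircleDeg1Lift) (ρ : ℝ) (n m : ℕ) (x y : ℝ) :
    logSlope F (q ρ n) x y + logSlope F (q ρ m) (ret F ρ n x) (ret F ρ n y) =
      logSlope F (q ρ m) x y + logSlope F (q ρ n) (ret F ρ m x) (ret F ρ m y) := by
  rw [logSlope_ret, logSlope_ret, logSlope_add_comm]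

end logSlope

namespace IrrationalLift

variable {F : CircleDeg1Lift} {ρ α V : ℝ}

theorem iterate_mem_uIcc (F : CircleDeg1Lift) (s : ℕ) {u a b : ℝ} (h : u ∈ uIcc a b) :
    F^[s] u ∈ uIcc (F^[s] a) (F^[s] b) :=
  (F.monotone.iterate s).image_uIcc_subset (mem_image_of_mem _ h)

theorem abs_sub_le_of_mem_uIcc {a b u v : ℝ} (hu : u ∈ uIcc a b) (hv : v ∈ uIcc a b) :
    |u - v| ≤ |a - b| := by
  rw [abs_sub_comm u, abs_sub_comm a]
  exact abs_sub_le_of_uIcc_subset_uIcc (uIcc_subset_uIcc hu hv)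

theorem sum_abs_iterate_sub_le (h : IrrationalLift F ρ α V) {n m : ℕ} {x u v : ℝ}
    (hm : m ≤ q ρ (n + 1)) (hu : u ∈ uIcc x (ret F ρ n x)) (hv : v ∈ uIcc x (ret F ρ n x)) :
    ∑ s ∈ Finset.range m, |F^[s] u - F^[s] v| ≤ 3 := by
  refine le_trans ?_ (sum_gap_le h.translationNumber_eq h.irrational n x)
  refine (Finset.sum_le_sum fun s _ => ?_).trans (Finset.sum_le_sum_of_subset_of_nonneg
    (Finset.range_mono hm) fun _ _ _ => abs_nonneg _)
  rw [← abs_iterate_sub_iterate_ret]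
  exact abs_sub_le_of_mem_uIcc (iterate_mem_uIcc F s hu) (iterate_mem_uIcc F s hv)

theorem abs_logSlope_sub_le (h : IrrationalLift F ρ α V) {n m : ℕ} {x u v : ℝ} (w : ℝ)
    (hm : m ≤ q ρ (n + 1)) (hu : u ∈ uIcc x (ret F ρ n x)) (hv : v ∈ uIcc x (ret F ρ n x)) :
    |logSlope F m u w - logSlope F m w v| ≤ V * 3 :=
  (CircleDynamics.abs_logSlope_sub_le h.bound m u w v).trans
    (mul_le_mul_of_nonneg_left (h.sum_abs_iterate_sub_le hm hu hv) h.bound.nonneg)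

theorem abs_logSlope_self_sub_le (h : IrrationalLift F ρ α V) {n m : ℕ} {x u v : ℝ}
    (hm : m ≤ q ρ (n + 1)) (hu : u ∈ uIcc x (ret F ρ n x)) (hv : v ∈ uIcc x (ret F ρ n x)) :
    |logSlope F m u u - logSlope F m v v| ≤ 6 * V := by
  have h1 := abs_logSlope_sub_le h u hm hu hv
  have h2 := abs_logSlope_sub_le h v hm hu hv
  have := abs_sub_le (logSlope F m u u) (logSlope F m u v) (logSlope F m v v)
  linarith

/-- A segment of the partition starting at some F^i x contains z modulo 1, and distortion along it
costs 6V. Replacing x by F^i x costs, by the cocycle relation, the difference of log (F^i)' at x and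
at its return, again at most 6V. For q_0 = 1 the distortion bound over an interval of length at most
1 suffices. -/
theorem abs_logSlope_q_sub_le (h : IrrationalLift F ρ α V) (n : ℕ) (x z : ℝ) :
    |logSlope F (q ρ n) x x - logSlope F (q ρ n) z z| ≤ 12 * V := by
  have hV := h.bound.nonneg
  cases n with
  | zero =>
    set k : ℤ := ⌊x - z⌋
    rw [← logSlope_add_int F _ z z k]
    set w := z + k
    have hw : |x - w| ≤ 1 := by
      have h1 := Int.floor_le (x - z)
      have h2 := Int.lt_floor_add_one (x - z)
      rw [abs_le]
      constructor <;> linarith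
    have h1 := CircleDynamics.abs_logSlope_sub_le h.bound (q ρ 0) x x w
    have h2 := CircleDynamics.abs_logSlope_sub_le h.bound (q ρ 0) x w w
    rw [q_zero] at *
    simp only [Finset.range_one, Finset.sum_singleton, Function.iterate_zero, id] at h1 h2
    have := abs_sub_le (logSlope F 1 x x) (logSlope F 1 x w) (logSlope F 1 w w)
    nlinarith
  | succ n =>
    obtain ⟨i, k, hik⟩ := exists_mem_partition h.translationNumber_eq h.irrational n x z
    rw [← logSlope_add_int F _ z z k]
    have hq := q_le_q_succ h.irrational n
    have hq' := q_le_q_succ h.irrational (n + 1)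
    have h1 : |logSlope F (q ρ (n + 1)) (F^[i] x) (F^[i] x) -
        logSlope F (q ρ (n + 1)) (z + k) (z + k)| ≤ 6 * V := by
      rcases hik with ⟨-, hz⟩ | ⟨-, hz⟩
      · exact h.abs_logSlope_self_sub_le le_rfl left_mem_uIcc hz
      · exact h.abs_logSlope_self_sub_le hq' left_mem_uIcc hz
    have h2 : |logSlope F i x x - logSlope F i (ret F ρ (n + 1) x) (ret F ρ (n + 1) x)| ≤ 6 * V :=
      h.abs_logSlope_self_sub_le (n := n + 1) (by lia) left_mem_uIcc right_mem_uIcc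
    have h3 := logSlope_add_comm F i (q ρ (n + 1)) x x
    rw [← logSlope_ret] at h3
    have h4 := abs_sub_le (logSlope F (q ρ (n + 1)) x x)
      (logSlope F (q ρ (n + 1)) (F^[i] x) (F^[i] x)) (logSlope F (q ρ (n + 1)) (z + k) (z + k))
    have h5 : logSlope F (q ρ (n + 1)) x x - logSlope F (q ρ (n + 1)) (F^[i] x) (F^[i] x) =
      logSlope F i x x - logSlope F i (ret F ρ (n + 1) x) (ret F ρ (n + 1) x) := by linarith
    rw [h5] at h4
    linarith

/-- Denjoy's inequality. -/
theorem abs_logSlope_q_le (h : IrrationalLift F ρ α V) (n : ℕ) (x y : ℝ) :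
    |logSlope F (q ρ n) x y| ≤ 12 * V := by
  obtain ⟨c, hc⟩ := exists_logSlope_eq h.contDiff h.deriv_pos (q ρ n) x y
  -- The mean slope of a degree one map over a full period is 1, so the derivative of the iterate
  -- equals 1 somewhere; this turns the oscillation bound into an absolute one.
  obtain ⟨z, hz⟩ := exists_logSlope_eq h.contDiff h.deriv_pos (q ρ n) 1 0
  have h1 := exp_logSlope_mul h.contDiff h.deriv_pos (q ρ n) 1 0
  have h2 : F^[q ρ n] 1 = F^[q ρ n] 0 + 1 := by
    have := iterate_add_int F (q ρ n) 0 1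
    simpa using this
  rw [h2, hz] at h1
  have h3 : logSlope F (q ρ n) z z = 0 := Real.exp_eq_one_iff _ |>.1 (by linarith)
  have := h.abs_logSlope_q_sub_le n c z
  rw [hc]
  rwa [h3, sub_zero] at this

theorem ret_sub_ret (h : IrrationalLift F ρ α V) (n : ℕ) (x y : ℝ) :
    ret F ρ n x - ret F ρ n y = Real.exp (logSlope F (q ρ n) x y) * (x - y) := by
  rw [exp_logSlope_mul h.contDiff h.deriv_pos]
  unfold ret; ring

theorem gap_ret (h : IrrationalLift F ρ α V) (n m : ℕ) (x : ℝ) :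
    gap F ρ n (ret F ρ m x) =
      Real.exp (logSlope F (q ρ m) (ret F ρ n x) x) * gap F ρ n x := by
  unfold gap
  rw [ret_comm, h.ret_sub_ret, abs_mul, Real.abs_exp]

theorem gap_pos (h : IrrationalLift F ρ α V) (n : ℕ) (x : ℝ) : 0 < gap F ρ n x :=
  CircleDynamics.gap_pos h.translationNumber_eq h.irrational n x

theorem gap_ret_le (h : IrrationalLift F ρ α V) (n m : ℕ) (x : ℝ) :
    gap F ρ n (ret F ρ m x) ≤ Real.exp (12 * V) * gap F ρ n x := by
  rw [h.gap_ret]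
  refine mul_le_mul_of_nonneg_right (Real.exp_le_exp.2 ?_) (h.gap_pos n x).le
  exact (abs_le.1 (h.abs_logSlope_q_le _ _ _)).2

theorem le_gap_ret (h : IrrationalLift F ρ α V) (n m : ℕ) (x : ℝ) :
    gap F ρ n x ≤ Real.exp (12 * V) * gap F ρ n (ret F ρ m x) := by
  rw [h.gap_ret, ← mul_assoc, ← Real.exp_add]
  refine le_mul_of_one_le_left (h.gap_pos n x).le (Real.one_le_exp ?_)
  have := (abs_le.1 (h.abs_logSlope_q_le m (ret F ρ n x) x)).1
  linarith

/-- At r_n x the segment of level n+1 points back into [x, r_n x], so it is shorter than that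
segment; Denjoy's inequality carries the bound back to x. -/
theorem gap_succ_le (h : IrrationalLift F ρ α V) (n : ℕ) (x : ℝ) :
    gap F ρ (n + 1) x ≤ Real.exp (12 * V) * gap F ρ n x := by
  refine (h.le_gap_ret (n + 1) n x).trans (mul_le_mul_of_nonneg_left ?_ (Real.exp_pos _).le)
  have h1 := ret_succ_ret_mem_uIcc h.translationNumber_eq h.irrational n x
  exact abs_sub_right_of_mem_uIcc h1 |>.trans_eq' (abs_sub_comm _ _)

/-- Two adjacent segments of level n+2, comparable by Denjoy's inequality, fit into one of level n.
-/
theorem gap_contract (h : IrrationalLift F ρ α V) (n : ℕ) (x : ℝ) :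
    (1 + Real.exp (12 * V)) * gap F ρ (n + 2) x ≤ Real.exp (12 * V) * gap F ρ n x := by
  have h1 := h.le_gap_ret (n + 2) (n + 2) x
  have h2 := abs_sub_left_of_mem_uIcc
    (ret_ret_mem_uIcc h.translationNumber_eq h.irrational n x)
  have h3 := (gap_eq h.translationNumber_eq h.irrational (n + 2) x).1
  have h4 := (gap_eq h.translationNumber_eq h.irrational (n + 2) (ret F ρ (n + 2) x)).1
  have h5 : gap F ρ (n + 2) x + gap F ρ (n + 2) (ret F ρ (n + 2) x) ≤ gap F ρ n x := by
    refine le_trans ?_ h2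
    rw [h3, h4, ← mul_add]
    refine (le_abs_self _).trans_eq ?_
    rw [abs_mul, abs_pow, abs_neg, abs_one, one_pow, one_mul]
    congr 1; ring
  have := mul_le_mul_of_nonneg_left h5 (Real.exp_pos (12 * V)).le
  linarith

end IrrationalLift

/-! ### Comparison of gaps at a point with maximal gaps. -/

/-- The maximal `n`-th gap. -/
def maxGap (F : CircleDeg1Lift) (ρ : ℝ) (n : ℕ) : ℝ := ⨆ x : ℝ, gap F ρ n x

namespace IrrationalLift

variable {F : CircleDeg1Lift} {ρ α V : ℝ}

theorem gap_le_maxGap (h : IrrationalLift F ρ α V) (n : ℕ) (x : ℝ) :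
    gap F ρ n x ≤ maxGap F ρ n :=
  le_ciSup (f := fun x => gap F ρ n x) ⟨1, by
    rintro _ ⟨y, rfl⟩; exact (gap_lt_one h.translationNumber_eq h.irrational n y).le⟩ x

theorem maxGap_pos (h : IrrationalLift F ρ α V) (n : ℕ) : 0 < maxGap F ρ n :=
  (h.gap_pos n 0).trans_le (h.gap_le_maxGap n 0)

theorem maxGap_succ_le (h : IrrationalLift F ρ α V) (n : ℕ) :
    maxGap F ρ (n + 1) ≤ Real.exp (12 * V) * maxGap F ρ n :=
  ciSup_le fun x => (h.gap_succ_le n x).trans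
    (mul_le_mul_of_nonneg_left (h.gap_le_maxGap n x) (Real.exp_pos _).le)

theorem maxGap_add_two_le (h : IrrationalLift F ρ α V) (n : ℕ) :
    maxGap F ρ (n + 2) ≤ maxGap F ρ n :=
  ciSup_le fun x => (gap_add_two_le h.translationNumber_eq h.irrational n x).trans
    (h.gap_le_maxGap n x)

theorem ret_monotone (F : CircleDeg1Lift) (ρ : ℝ) (n : ℕ) : Monotone (ret F ρ n) :=
  fun _ _ h => sub_le_sub_right ((F.monotone.iterate _) h) _

theorem ret_mem_uIcc {n : ℕ} {z a b : ℝ} (hz : z ∈ uIcc a b) :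
    ret F ρ n z ∈ uIcc (ret F ρ n a) (ret F ρ n b) :=
  (ret_monotone F ρ n).image_uIcc_subset (mem_image_of_mem _ hz)

theorem gap_le_of_mem_uIcc_ret (h : IrrationalLift F ρ α V) (n : ℕ) {y z : ℝ}
    (hz : z ∈ uIcc y (ret F ρ n y)) :
    gap F ρ n z ≤ (1 + Real.exp (12 * V)) * gap F ρ n y := by
  have h1 := h.gap_ret_le n n y
  have h2 : |ret F ρ n z - ret F ρ n y| ≤ gap F ρ n (ret F ρ n y) :=
    abs_sub_left_of_mem_uIcc (ret_mem_uIcc hz)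
  have h3 : |ret F ρ n y - z| ≤ gap F ρ n y := abs_sub_right_of_mem_uIcc hz
  have h4 := abs_sub_le (ret F ρ n z) (ret F ρ n y) z
  unfold gap at *
  linarith

theorem gap_le_of_mem_uIcc_ret_succ (h : IrrationalLift F ρ α V) (n : ℕ) {y z : ℝ}
    (hz : z ∈ uIcc y (ret F ρ (n + 1) y)) :
    gap F ρ n z ≤ (1 + Real.exp (12 * V)) * gap F ρ n y := by
  have h1 := h.gap_succ_le n y
  have h2 : ret F ρ n z ∈ uIcc y (ret F ρ n y) := by
    refine uIcc_subset_uIcc right_mem_uIcc ?_ (ret_mem_uIcc hz)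
    rw [ret_comm]
    exact ret_succ_ret_mem_uIcc h.translationNumber_eq h.irrational n y
  have h3 : |ret F ρ n z - y| ≤ gap F ρ n y := abs_sub_left_of_mem_uIcc h2
  have h4 : |z - y| ≤ gap F ρ (n + 1) y := abs_sub_left_of_mem_uIcc hz
  have h5 := abs_sub_le (ret F ρ n z) y z
  rw [abs_sub_comm y z] at h5
  unfold gap at *
  linarith

/-- The ratio of two gaps at the same point is controlled by the ratio of the maximal gaps. -/
theorem gap_mul_maxGap_le (h : IrrationalLift F ρ α V) {j n : ℕ} (hjn : j ≤ n) (x : ℝ) :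
    gap F ρ n x * maxGap F ρ j ≤
      (1 + Real.exp (12 * V)) * Real.exp (6 * V) * (gap F ρ j x * maxGap F ρ n) := by
  rw [mul_comm, maxGap, Real.iSup_mul_of_nonneg (h.gap_pos n x).le]
  refine ciSup_le fun z => ?_
  -- The gap at an arbitrary z is dominated by the gap at an orbit point F^i x. Ratios of gaps are
  -- carried from x to F^i x with bounded distortion, since i does not exceed q_{j+1}.
  obtain ⟨i, hi, hz⟩ : ∃ i ≤ q ρ (j + 1),
      gap F ρ j z ≤ (1 + Real.exp (12 * V)) * gap F ρ j (F^[i] x) := by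
    obtain ⟨i, k, hik⟩ := exists_mem_partition h.translationNumber_eq h.irrational j x z
    rw [← gap_add_int j z k]
    rcases hik with ⟨hi, hz⟩ | ⟨hi, hz⟩
    · exact ⟨i, hi.le, h.gap_le_of_mem_uIcc_ret j hz⟩
    · exact ⟨i, hi.le.trans (q_le_q_succ h.irrational j), h.gap_le_of_mem_uIcc_ret_succ j hz⟩
  have hslope : ∀ m, gap F ρ m (F^[i] x) =
      Real.exp (logSlope F i (ret F ρ m x) x) * gap F ρ m x := fun m => by
    unfold gap
    rw [← iterate_ret, ← exp_logSlope_mul h.contDiff h.deriv_pos, abs_mul, Real.abs_exp]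
  have hq := q_le_q_succ h.irrational (j + 1)
  have hdist : ∀ m, (∃ l, j ≤ l ∧ l ≤ j + 1 ∧ ret F ρ m x ∈ uIcc x (ret F ρ l x)) →
      |logSlope F i (ret F ρ m x) x - logSlope F i x x| ≤ V * 3 := by
    rintro m ⟨l, hl, hl', hm⟩
    refine h.abs_logSlope_sub_le x (hi.trans ?_) hm left_mem_uIcc
    rcases (by lia : l = j ∨ l = j + 1) with rfl | rfl
    · exact le_rfl
    · exact hq
  have d1 := hdist j ⟨j, le_rfl, by lia, right_mem_uIcc⟩
  -- By parity of n - j, the segment of level n lies in the one of level j or in the one of level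
  -- j+1.
  have d2 := hdist n (by
    obtain ⟨k, hk | hk⟩ := Nat.even_or_odd' (n - j)
    · refine ⟨j, le_rfl, by lia, ?_⟩
      obtain rfl : n = j + 2 * k := by lia
      exact ret_mem_uIcc_ret h.translationNumber_eq h.irrational j k x
    · refine ⟨j + 1, by lia, le_rfl, ?_⟩
      obtain rfl : n = j + 1 + 2 * k := by lia
      exact ret_mem_uIcc_ret h.translationNumber_eq h.irrational (j + 1) k x)
  have h3 : gap F ρ n x * gap F ρ j (F^[i] x) ≤
      Real.exp (6 * V) * (gap F ρ j x * gap F ρ n (F^[i] x)) := by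
    rw [hslope, hslope]
    have : Real.exp (logSlope F i (ret F ρ j x) x) ≤
        Real.exp (6 * V) * Real.exp (logSlope F i (ret F ρ n x) x) := by
      rw [← Real.exp_add, Real.exp_le_exp]
      linarith [(abs_le.1 d1).2, (abs_le.1 d2).1]
    have hp := mul_pos (h.gap_pos n x) (h.gap_pos j x)
    calc _ = Real.exp (logSlope F i (ret F ρ j x) x) * (gap F ρ n x * gap F ρ j x) := by ring
      _ ≤ Real.exp (6 * V) * Real.exp (logSlope F i (ret F ρ n x) x) *
          (gap F ρ n x * gap F ρ j x) := by gcongr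
      _ = _ := by ring
  have h4 := h.gap_le_maxGap n (F^[i] x)
  have hj := (h.gap_pos j x).le
  have hn := (h.gap_pos n x).le
  calc gap F ρ j z * gap F ρ n x
      ≤ (1 + Real.exp (12 * V)) * gap F ρ j (F^[i] x) * gap F ρ n x := by gcongr
    _ = (1 + Real.exp (12 * V)) * (gap F ρ n x * gap F ρ j (F^[i] x)) := by ring
    _ ≤ (1 + Real.exp (12 * V)) *
        (Real.exp (6 * V) * (gap F ρ j x * gap F ρ n (F^[i] x))) := by gcongr
    _ ≤ (1 + Real.exp (12 * V)) *
        (Real.exp (6 * V) * (gap F ρ j x * maxGap F ρ n)) := by gcongr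
    _ = _ := by ring

end IrrationalLift

/-! ### Recursions for the ratio distortion and the relative change of length. -/

namespace IrrationalLift

variable {F : CircleDeg1Lift} {ρ α V : ℝ}

/-- Transfers the Hölder exponent from the longer segment to the shorter one: the longer length then
enters linearly and can be summed along the orbit, while the error is governed by the finer level.
-/
theorem mul_rpow_le_rpow_mul {a b α : ℝ} (ha : 0 < a) (hab : a ≤ b) (hα : α ≤ 1) :
    a * b ^ α ≤ a ^ α * b := by
  have hb := ha.trans_le hab
  calc a * b ^ α = a ^ α * a ^ (1 - α) * b ^ α := by
        rw [← Real.rpow_add ha, add_sub_cancel, Real.rpow_one]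
    _ ≤ a ^ α * b ^ (1 - α) * b ^ α := by
        have := Real.rpow_le_rpow ha.le hab (sub_nonneg.2 hα)
        gcongr
    _ = a ^ α * b := by
        rw [mul_assoc, ← Real.rpow_add hb, sub_add_cancel, Real.rpow_one]

/-- The oscillation of the ratio distortion of iterates, as a function of the middle point. -/
theorem abs_ratio_sub_ratio_le (h : IrrationalLift F ρ α V) (hα : α ∈ Icc (0 : ℝ) 1) {n m : ℕ}
    (k : ℕ) (hm : m ≤ q ρ (n + 1)) {x y y' : ℝ} (hy : y ∈ uIcc x (ret F ρ n x))
    (hy' : y' ∈ uIcc x (ret F ρ n x)) :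
    |(logSlope F m x y - logSlope F m y (ret F ρ (n + 2 * k) x)) -
      (logSlope F m x y' - logSlope F m y' (ret F ρ (n + 2 * k) x))| ≤
      3 * V * maxGap F ρ (n + 2 * k) ^ α := by
  have hV := h.bound.nonneg
  set v := ret F ρ (n + 2 * k) x with hv
  have hvm : v ∈ uIcc x (ret F ρ n x) :=
    ret_mem_uIcc_ret h.translationNumber_eq h.irrational n k x
  have e : (logSlope F m x y - logSlope F m y v) - (logSlope F m x y' - logSlope F m y' v) =
      ∑ s ∈ Finset.range m,
        ((Real.log (meanDeriv F (F^[s] x) (F^[s] y)) - Real.log (meanDeriv F (F^[s] y) (F^[s] v))) -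
        (Real.log (meanDeriv F (F^[s] x) (F^[s] y')) -
          Real.log (meanDeriv F (F^[s] y') (F^[s] v)))) := by
    simp only [logSlope, Finset.sum_sub_distrib]
  rw [e]
  have hsum := sum_gap_le h.translationNumber_eq h.irrational n x
  have hM := Real.rpow_nonneg (h.maxGap_pos (n + 2 * k)).le α
  calc _ ≤ ∑ s ∈ Finset.range m,
        V * maxGap F ρ (n + 2 * k) ^ α * gap F ρ n (F^[s] x) := by
        refine (Finset.abs_sum_le_sum_abs _ _).trans (Finset.sum_le_sum fun s _ => ?_)
        have hg := abs_iterate_sub_iterate_ret (F := F) (ρ := ρ) n s x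
        have hg' := abs_iterate_sub_iterate_ret (F := F) (ρ := ρ) (n + 2 * k) s x
        have hle : |F^[s] x - F^[s] v| ≤ |F^[s] x - F^[s] (ret F ρ n x)| :=
          abs_sub_le_of_mem_uIcc left_mem_uIcc (iterate_mem_uIcc F s hvm)
        refine (h.bound.cross (F^[s] x) (F^[s] (ret F ρ n x)) _ _ _ _ ?_ left_mem_uIcc
          (iterate_mem_uIcc F s hvm) (iterate_mem_uIcc F s hy)
          (iterate_mem_uIcc F s hy')).trans ?_
        · rw [hg]; exact (gap_lt_one h.translationNumber_eq h.irrational _ _).le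
        · rw [hg, hg'] at hle
          rw [hg, hg', mul_assoc, mul_assoc]
          refine mul_le_mul_of_nonneg_left ((mul_rpow_le_rpow_mul (h.gap_pos _ _) hle hα.2).trans
            ?_) hV
          refine mul_le_mul_of_nonneg_right ?_ (h.gap_pos _ _).le
          exact Real.rpow_le_rpow (h.gap_pos _ _).le (h.gap_le_maxGap _ _) hα.1
    _ = V * maxGap F ρ (n + 2 * k) ^ α * ∑ s ∈ Finset.range m, gap F ρ n (F^[s] x) := by
        rw [Finset.mul_sum]
    _ ≤ V * maxGap F ρ (n + 2 * k) ^ α * 3 := by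
        refine mul_le_mul_of_nonneg_left ?_ (by positivity)
        exact (Finset.sum_le_sum_of_subset_of_nonneg (Finset.range_mono hm)
          fun _ _ _ => (h.gap_pos _ _).le).trans hsum
    _ = _ := by ring

end IrrationalLift

/-- The logarithm of the ratio distortion of the `(n + 1)`-st return at the endpoints of the
`n`-th fundamental segment of `x` and the point `y`. -/
def logM (F : CircleDeg1Lift) (ρ : ℝ) (n : ℕ) (x y : ℝ) : ℝ :=
  logSlope F (q ρ (n + 1)) x y - logSlope F (q ρ (n + 1)) y (ret F ρ n x)

/-- The logarithm of the ratio distortion of the `n`-th return at the endpoints of the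
`(n + 1)`-st fundamental segment of `x` and the point `y`. -/
def logK (F : CircleDeg1Lift) (ρ : ℝ) (n : ℕ) (x y : ℝ) : ℝ :=
  logSlope F (q ρ n) x y - logSlope F (q ρ n) y (ret F ρ (n + 1) x)

/-- The larger of two values of the deviation of the ratio distortion from `1`. -/
def devM (F : CircleDeg1Lift) (ρ : ℝ) (n : ℕ) (x : ℝ) : ℝ :=
  max |Real.exp (logM F ρ n x x) - 1| |Real.exp (logM F ρ n x (ret F ρ (n + 2) x)) - 1|

/-- The relative change of length of the `n`-th fundamental segment of `x` under the
`(n + 1)`-st return. -/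
def devA (F : CircleDeg1Lift) (ρ : ℝ) (n : ℕ) (x : ℝ) : ℝ :=
  |Real.exp (logSlope F (q ρ (n + 1)) x (ret F ρ n x)) - 1|

theorem abs_exp_sub_exp_le {a b B : ℝ} (ha : a ≤ B) (hb : b ≤ B) :
    |Real.exp a - Real.exp b| ≤ Real.exp B * |a - b| := by
  have := Convex.norm_image_sub_le_of_norm_hasDerivWithin_le
    (f := Real.exp) (f' := Real.exp) (s := Iic B) (C := Real.exp B) (x := b) (y := a)
    (fun t _ => (Real.hasDerivAt_exp t).hasDerivWithinAt)
    (fun t ht => by rw [Real.norm_eq_abs, Real.abs_exp]; exact Real.exp_le_exp.2 ht)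
    (convex_Iic B) hb ha
  simpa using this

namespace IrrationalLift

variable {F : CircleDeg1Lift} {ρ α V : ℝ}

/-- The left side telescopes to log r_{n+1}'(x) - log r_{n+1}'(r_n x), the right side to log r_n'(x)
- log r_n'(r_{n+1} x); these agree because the returns commute. -/
theorem logM_add_logM (h : IrrationalLift F ρ α V) (n : ℕ) (x : ℝ) :
    logM F ρ n x x + logM F ρ n x (ret F ρ n x) =
      logK F ρ n x x + logK F ρ n x (ret F ρ (n + 1) x) := by
  unfold logM logK
  rw [logSlope_comm h.contDiff (q ρ (n + 1)) x (ret F ρ n x),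
    logSlope_comm h.contDiff (q ρ n) x (ret F ρ (n + 1) x)]
  linarith [logSlope_ret_comm F ρ n (n + 1) x x]

/-- With b = r_{n+2} x and c = r_n x, the mean slope of r_{n+1} over [x, c] is the length-weighted
average of those over [x, b] and [b, c]. Dividing by the slope over [b, c] gives the identity, whose
weight |x - b|/|x - c| is the small factor of the recursion. -/
theorem exp_logK_sub_one (h : IrrationalLift F ρ α V) (n : ℕ) (x : ℝ) :
    |Real.exp (logK F ρ (n + 1) x (ret F ρ n x)) - 1| =
      gap F ρ (n + 2) x / gap F ρ n x *
        |Real.exp (logM F ρ n x (ret F ρ (n + 2) x)) - 1| := by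
  unfold logM logK
  set b := ret F ρ (n + 2) x with hb
  set c := ret F ρ n x with hc
  set m := q ρ (n + 1)
  have e1 := exp_logSlope_mul h.contDiff h.deriv_pos m x b
  have e2 := exp_logSlope_mul h.contDiff h.deriv_pos m b c
  have e3 := exp_logSlope_mul h.contDiff h.deriv_pos m x c
  rw [show n + 1 + 1 = n + 2 from rfl, logSlope_comm h.contDiff m c b, Real.exp_sub,
    Real.exp_sub]
  have hpos := Real.exp_pos (logSlope F m b c)
  set E2 := Real.exp (logSlope F m b c)
  have g : gap F ρ n x = |x - c| := abs_sub_comm _ _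
  have g' : gap F ρ (n + 2) x = |x - b| := abs_sub_comm _ _
  have hgp := h.gap_pos n x
  rw [g] at hgp
  have hne : x - c ≠ 0 := abs_pos.1 hgp
  rw [g, g', ← abs_div, ← abs_mul]
  congr 1
  field_simp
  linear_combination e3 - e1 - e2

/-- Both sides are the absolute value of r_{n+1} r_n x - r_{n+1} x - r_n x + x, which is symmetric
in the two returns. -/
theorem devA_mul_gap (h : IrrationalLift F ρ α V) (n : ℕ) (x : ℝ) :
    devA F ρ n x * gap F ρ n x =
      |Real.exp (logSlope F (q ρ n) x (ret F ρ (n + 1) x)) - 1| * gap F ρ (n + 1) x := by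
  unfold devA gap
  rw [← abs_mul, ← abs_mul]
  congr 1
  have e1 := h.ret_sub_ret (n + 1) x (ret F ρ n x)
  have e2 := h.ret_sub_ret n x (ret F ρ (n + 1) x)
  rw [ret_comm] at e1
  linear_combination e1 - e2

theorem abs_logSlope_sub_logSlope_le (h : IrrationalLift F ρ α V) (n : ℕ) (x y z w : ℝ) :
    |logSlope F (q ρ n) x y - logSlope F (q ρ n) z w| ≤ 24 * V := by
  have h1 := abs_sub (logSlope F (q ρ n) x y) (logSlope F (q ρ n) z w)
  have h2 := h.abs_logSlope_q_le n x y
  have h3 := h.abs_logSlope_q_le n z w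
  linarith

theorem abs_logM_le (h : IrrationalLift F ρ α V) (n : ℕ) (x y : ℝ) :
    |logM F ρ n x y| ≤ 24 * V := h.abs_logSlope_sub_logSlope_le _ _ _ _ _

theorem abs_logK_le (h : IrrationalLift F ρ α V) (n : ℕ) (x y : ℝ) :
    |logK F ρ n x y| ≤ 24 * V := h.abs_logSlope_sub_logSlope_le _ _ _ _ _

theorem abs_logM_sub_logM_le (h : IrrationalLift F ρ α V) (hα : α ∈ Icc (0 : ℝ) 1) (n : ℕ)
    {x y y' : ℝ} (hy : y ∈ uIcc x (ret F ρ n x)) (hy' : y' ∈ uIcc x (ret F ρ n x)) :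
    |logM F ρ n x y - logM F ρ n x y'| ≤ 3 * V * maxGap F ρ n ^ α :=
  h.abs_ratio_sub_ratio_le hα 0 le_rfl hy hy'

theorem abs_logK_sub_logK_le (h : IrrationalLift F ρ α V) (hα : α ∈ Icc (0 : ℝ) 1) (n : ℕ)
    {x y y' : ℝ} (hy : y ∈ uIcc x (ret F ρ (n + 1) x)) (hy' : y' ∈ uIcc x (ret F ρ (n + 1) x)) :
    |logK F ρ n x y - logK F ρ n x y'| ≤ 3 * V * maxGap F ρ (n + 1) ^ α :=
  h.abs_ratio_sub_ratio_le hα 0 ((q_le_q_succ h.irrational n).trans (q_le_q_succ h.irrational _))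
    hy hy'

theorem abs_logK_sub_logK_ret_le (h : IrrationalLift F ρ α V) (hα : α ∈ Icc (0 : ℝ) 1) (n : ℕ)
    (x : ℝ) : |logK F ρ (n + 1) x x - logK F ρ (n + 1) x (ret F ρ n x)| ≤
      3 * V * maxGap F ρ (n + 2) ^ α :=
  h.abs_ratio_sub_ratio_le (n := n) hα 1 le_rfl left_mem_uIcc right_mem_uIcc

theorem maxGap_succ_rpow_le (h : IrrationalLift F ρ α V) (hα : α ∈ Icc (0 : ℝ) 1) (n : ℕ) :
    maxGap F ρ (n + 1) ^ α ≤ Real.exp (12 * V) * maxGap F ρ n ^ α := by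
  have hV := h.bound.nonneg
  have h1 : 1 ≤ Real.exp (12 * V) := Real.one_le_exp (by positivity)
  calc _ ≤ (Real.exp (12 * V) * maxGap F ρ n) ^ α :=
        Real.rpow_le_rpow (h.maxGap_pos _).le (h.maxGap_succ_le n) hα.1
    _ = Real.exp (12 * V) ^ α * maxGap F ρ n ^ α :=
        Real.mul_rpow (Real.exp_pos _).le (h.maxGap_pos _).le
    _ ≤ _ := by
        refine mul_le_mul_of_nonneg_right ?_ (Real.rpow_nonneg (h.maxGap_pos _).le _)
        simpa using Real.rpow_le_rpow_of_exponent_le h1 hα.2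

/-- Since both quantities are nearly constant in the middle point, `logM_add_logM` reads 2 `logM` ≈
2 `logK`. The point r_n x lies outside the segment [x, r_{n+2} x] that defines this `logK`;
`abs_logK_sub_logK_ret_le` reaches it at the cost of a power of the gap of level n+2 only. -/
theorem abs_logM_succ_sub_logK_le (h : IrrationalLift F ρ α V) (hα : α ∈ Icc (0 : ℝ) 1) (n : ℕ)
    {x y : ℝ} (hy : y ∈ uIcc x (ret F ρ (n + 1) x)) :
    |logM F ρ (n + 1) x y - logK F ρ (n + 1) x (ret F ρ n x)| ≤
      9 * V * Real.exp (12 * V) * maxGap F ρ (n + 1) ^ α := by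
  have hV := h.bound.nonneg
  have h1 := h.abs_logM_sub_logM_le hα (n + 1) hy left_mem_uIcc
  have h2 := h.abs_logM_sub_logM_le hα (n + 1) (x := x) right_mem_uIcc left_mem_uIcc
  have h3 := h.abs_logK_sub_logK_le hα (n + 1) (x := x) right_mem_uIcc left_mem_uIcc
  have h4 := h.abs_logK_sub_logK_ret_le hα n x
  have h5 := h.logM_add_logM (n + 1) x
  have h6 := h.maxGap_succ_rpow_le hα (n + 1)
  have h7 : (1 : ℝ) ≤ Real.exp (12 * V) := Real.one_le_exp (by positivity)
  have h8 := Real.rpow_nonneg (h.maxGap_pos (n + 1)).le α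
  have h9 : V * maxGap F ρ (n + 2) ^ α ≤
      V * (Real.exp (12 * V) * maxGap F ρ (n + 1) ^ α) := mul_le_mul_of_nonneg_left h6 hV
  have h10 : V * maxGap F ρ (n + 1) ^ α ≤ V * (Real.exp (12 * V) * maxGap F ρ (n + 1) ^ α) :=
    mul_le_mul_of_nonneg_left (le_mul_of_one_le_left h8 h7) hV
  rw [show n + 1 + 1 = n + 2 from rfl] at *
  rw [abs_le] at *
  constructor <;> linarith [h1.1, h1.2, h2.1, h2.2, h3.1, h3.2, h4.1, h4.2]

theorem abs_exp_sub_one_le {a b B e : ℝ} (ha : |a| ≤ B) (hb : |b| ≤ B) (hab : |a - b| ≤ e) :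
    |Real.exp a - 1| ≤ |Real.exp b - 1| + Real.exp B * e := by
  have h1 := abs_exp_sub_exp_le ((le_abs_self a).trans ha) ((le_abs_self b).trans hb)
  have h2 := abs_sub_le (Real.exp a) (Real.exp b) 1
  have h3 := mul_le_mul_of_nonneg_left hab (Real.exp_pos B).le
  linarith

theorem exists_devM_succ_le (h : IrrationalLift F ρ α V) (hα : α ∈ Icc (0 : ℝ) 1) :
    ∃ C, 0 ≤ C ∧ ∀ n x, devM F ρ (n + 1) x ≤
      gap F ρ (n + 2) x / gap F ρ n x * devM F ρ n x + C * maxGap F ρ (n + 1) ^ α := by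
  have hV := h.bound.nonneg
  refine ⟨Real.exp (24 * V) * (9 * V * Real.exp (12 * V)), by positivity, fun n x => ?_⟩
  have key : ∀ y ∈ uIcc x (ret F ρ (n + 1) x), |Real.exp (logM F ρ (n + 1) x y) - 1| ≤
      gap F ρ (n + 2) x / gap F ρ n x * devM F ρ n x +
        Real.exp (24 * V) * (9 * V * Real.exp (12 * V)) * maxGap F ρ (n + 1) ^ α := by
    intro y hy
    have h1 := abs_exp_sub_one_le (h.abs_logM_le (n + 1) x y)
      (h.abs_logK_le (n + 1) x (ret F ρ n x)) (h.abs_logM_succ_sub_logK_le hα n hy)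
    rw [h.exp_logK_sub_one] at h1
    have h2 := mul_le_mul_of_nonneg_left
      (le_max_right |Real.exp (logM F ρ n x x) - 1| |Real.exp (logM F ρ n x (ret F ρ (n + 2) x)) - 1|)
      (div_pos (h.gap_pos (n + 2) x) (h.gap_pos n x)).le
    unfold devM
    linarith
  exact max_le (key x left_mem_uIcc)
    (key _ (ret_mem_uIcc_ret h.translationNumber_eq h.irrational (n + 1) 1 x))

theorem exists_devA_succ_le (h : IrrationalLift F ρ α V) (hα : α ∈ Icc (0 : ℝ) 1) :
    ∃ C, 0 ≤ C ∧ ∀ n x, devA F ρ (n + 1) x ≤ gap F ρ (n + 2) x / gap F ρ (n + 1) x *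
      (devA F ρ n x + C * devM F ρ n x + C * maxGap F ρ n ^ α) := by
  have hV := h.bound.nonneg
  set B := Real.exp (24 * V) with hB
  have hB1 : 1 ≤ B := Real.one_le_exp (by positivity)
  refine ⟨B * B * (2 + B * (3 * V)), by positivity, fun n x => ?_⟩
  have hg := h.gap_pos (n + 1) x
  have hA := h.devA_mul_gap (n + 1) x
  rw [← eq_div_iff hg.ne'] at hA
  rw [hA, mul_div_assoc, mul_comm]
  refine mul_le_mul_of_nonneg_left ?_ (div_pos (h.gap_pos (n + 2) x) hg).le
  set a := logSlope F (q ρ (n + 1)) x (ret F ρ n x) with ha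
  set m := logM F ρ n x x with hm
  set k := logK F ρ (n + 1) x x with hk
  -- The slopes of r_{n+1} over [x, r_n x] and [x, r_{n+2} x] are both compared with its derivative
  -- at x, by m and k respectively.
  have e : logSlope F (q ρ (n + 1)) x (ret F ρ (n + 1 + 1) x) = a + (m - k) := by
    simp only [ha, hm, hk, logM, logK]; ring
  have hkb := abs_le.1 (h.abs_logK_le (n + 1) x x)
  have hab := abs_le.1 (h.abs_logSlope_q_le (n + 1) x (ret F ρ n x))
  have k1 : |Real.exp k - 1| ≤ devM F ρ n x + B * (3 * V) * maxGap F ρ n ^ α := by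
    have h1 := abs_exp_sub_one_le (h.abs_logK_le (n + 1) x x)
      (h.abs_logK_le (n + 1) x (ret F ρ n x)) (h.abs_logK_sub_logK_ret_le hα n x)
    rw [h.exp_logK_sub_one] at h1
    have h2 : gap F ρ (n + 2) x / gap F ρ n x *
        |Real.exp (logM F ρ n x (ret F ρ (n + 2) x)) - 1| ≤ devM F ρ n x := by
      refine (mul_le_of_le_one_left (abs_nonneg _) ?_).trans (le_max_right _ _)
      exact div_le_one_of_le₀ (gap_add_two_le h.translationNumber_eq h.irrational n x)
        (h.gap_pos n x).le
    have h3 := Real.rpow_le_rpow (h.maxGap_pos (n + 2)).le (h.maxGap_add_two_le n) hα.1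
    have h4 : B * (3 * V) * maxGap F ρ (n + 2) ^ α ≤ B * (3 * V) * maxGap F ρ n ^ α :=
      mul_le_mul_of_nonneg_left h3 (by positivity)
    linarith
  have m1 : |Real.exp m - 1| ≤ devM F ρ n x := le_max_left _ _
  have e2 : |Real.exp (m - k) - 1| ≤ B * (|Real.exp m - 1| + |Real.exp k - 1|) := by
    have e3 : Real.exp (m - k) - 1 = Real.exp (-k) * ((Real.exp m - 1) - (Real.exp k - 1)) := by
      rw [Real.exp_neg, Real.exp_sub]
      have := (Real.exp_pos k).ne'
      field_simp
      ring
    rw [e3, abs_mul, Real.abs_exp]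
    exact mul_le_mul (Real.exp_le_exp.2 (by linarith [hkb.1])) (abs_sub _ _) (abs_nonneg _)
      (by positivity)
  have haB : Real.exp a ≤ B := Real.exp_le_exp.2 (by linarith [hab.2])
  have e4 : |Real.exp (a + (m - k)) - 1| ≤
      |Real.exp a - 1| + Real.exp a * |Real.exp (m - k) - 1| := by
    have e5 : Real.exp (a + (m - k)) - 1 =
        (Real.exp a - 1) + Real.exp a * (Real.exp (m - k) - 1) := by
      rw [Real.exp_add]; ring
    rw [e5]
    refine (abs_add_le _ _).trans_eq ?_
    rw [abs_mul, Real.abs_exp]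
  rw [e]
  have hD : 0 ≤ devM F ρ n x := (abs_nonneg _).trans m1
  have hM := Real.rpow_nonneg (h.maxGap_pos n).le α
  have hB0 : 0 ≤ B := by positivity
  calc _ ≤ |Real.exp a - 1| + B * (B * (devM F ρ n x +
          (devM F ρ n x + B * (3 * V) * maxGap F ρ n ^ α))) := by
        refine e4.trans (add_le_add le_rfl ?_)
        refine mul_le_mul haB (e2.trans ?_) (abs_nonneg _) hB0
        gcongr
    _ = devA F ρ n x + B * B * 2 * devM F ρ n x + B * B * (B * (3 * V)) * maxGap F ρ n ^ α := by
        unfold devA; ring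
    _ ≤ _ := by
        gcongr
        · nlinarith [mul_nonneg hB0 (mul_nonneg (by norm_num : (0:ℝ) ≤ 3) hV)]
        · linarith

end IrrationalLift

/-! ### Solving the recursions. -/

/-- Solution of the pair of recursive inequalities for the ratio distortion and for the relative
change of length, along a sequence `d` which contracts in two steps. -/
theorem add_le_of_recursive_le {d e m b : ℕ → ℝ} {c C : ℝ} (hc : 0 ≤ c) (hC : 0 ≤ C)
    (hd : ∀ n, 0 < d n) (hd1 : ∀ n, d (n + 1) ≤ c * d n)
    (hd2 : ∀ n, (1 + c) * d (n + 2) ≤ c * d n) (he : ∀ n, 0 ≤ e n) (hm : ∀ n, 0 ≤ m n)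
    (hm0 : m 0 ≤ C * e 0) (hms : ∀ n, m (n + 1) ≤ d (n + 2) / d n * m n + C * e (n + 1))
    (hb0 : b 0 ≤ C * (d 1 / d 0))
    (hbs : ∀ n, b (n + 1) ≤ d (n + 2) / d (n + 1) * (b n + C * m n + C * e n)) (n : ℕ) :
    b n + m n ≤ (C + C * (1 + C) * (1 + c) ^ 2) *
      (d (n + 1) / d 0 + ∑ j ∈ Finset.range (n + 1), d (n + 1) / d (j + 1) * e j) := by
  set X : ℕ → ℝ := fun n => ∑ j ∈ Finset.range (n + 1), m j / d (j + 1) with hX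
  set Y : ℕ → ℝ := fun n => ∑ j ∈ Finset.range (n + 1), e j / d (j + 1) with hY
  -- This normalisation turns the homogeneous factor d_{n+2}/d_n of the recursion into 1, so s_n
  -- only accumulates the errors.
  set s : ℕ → ℝ := fun n => m n / (d n * d (n + 1)) with hs
  -- W_n dominates the tail sums of d, through d_n + W_{n+1} ≤ W_n, and is itself O(d_n): this is
  -- where the two-step contraction enters.
  set W : ℕ → ℝ := fun n => (1 + c) * (d n + d (n + 1)) with hW
  have hs0 : ∀ n, 0 ≤ s n := fun n => div_nonneg (hm n) (mul_pos (hd _) (hd _)).le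
  have hW1 : ∀ n, d n + W (n + 1) ≤ W n := fun n => by
    simp only [hW]; nlinarith [hd2 n]
  have hW2 : ∀ n, W n ≤ (1 + c) ^ 2 * d n := fun n => by
    simp only [hW]; nlinarith [hd1 n]
  have hWpos : ∀ n, 0 ≤ W n := fun n => by
    have := hd n; have := hd (n + 1); positivity
  have hms' : ∀ n, m n / d (n + 1) = d n * s n := fun n => by
    have := (hd n).ne'; have := (hd (n + 1)).ne'
    simp only [hs]; field_simp
  have hWu : ∀ n, W n * (C * e n / (d n * d (n + 1))) ≤ (1 + c) ^ 2 * C * (e n / d (n + 1)) :=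
    fun n => by
      have h1 := hd n; have h2 := hd (n + 1)
      have := he n
      calc _ ≤ (1 + c) ^ 2 * d n * (C * e n / (d n * d (n + 1))) :=
            mul_le_mul_of_nonneg_right (hW2 n) (by positivity)
        _ = _ := by field_simp
  -- Summation by parts: the term W_{n+1} s_n pays in advance for the future effect of the errors
  -- accumulated so far, so the sum of m_j/d_{j+1} is bounded by that of e_j/d_{j+1} without a
  -- logarithmic loss.
  have claim1 : ∀ n, X n + W (n + 1) * s n ≤ (1 + c) ^ 2 * C * Y n := by
    intro n
    induction n with
    | zero =>
      simp only [hX, hY, zero_add, Finset.sum_range_one]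
      have h1 := hms' 0
      rw [zero_add] at h1
      rw [h1]
      have h2 : s 0 ≤ C * e 0 / (d 0 * d 1) :=
        div_le_div_of_nonneg_right hm0 (mul_pos (hd _) (hd _)).le
      calc _ = (d 0 + W 1) * s 0 := by ring
        _ ≤ W 0 * s 0 := mul_le_mul_of_nonneg_right (hW1 0) (hs0 0)
        _ ≤ W 0 * (C * e 0 / (d 0 * d 1)) := mul_le_mul_of_nonneg_left h2 (hWpos 0)
        _ ≤ _ := hWu 0
    | succ n ih =>
      have hXs : X (n + 1) = X n + d (n + 1) * s (n + 1) := by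
        rw [← hms']; exact Finset.sum_range_succ _ _
      have hYs : Y (n + 1) = Y n + e (n + 1) / d (n + 2) := Finset.sum_range_succ _ _
      have h2 : s (n + 1) ≤ s n + C * e (n + 1) / (d (n + 1) * d (n + 2)) := by
        have h := div_le_div_of_nonneg_right (hms n) (mul_pos (hd (n + 1)) (hd (n + 2))).le
        refine h.trans_eq ?_
        have := (hd n).ne'; have := (hd (n + 1)).ne'; have := (hd (n + 2)).ne'
        simp only [hs]; field_simp
      have h3 := mul_le_mul_of_nonneg_right (hW1 (n + 1)) (hs0 (n + 1))
      have h4 := mul_le_mul_of_nonneg_left h2 (hWpos (n + 1))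
      have h5 := hWu (n + 1)
      rw [hXs, hYs]
      rw [show n + 1 + 1 = n + 2 from rfl] at *
      linarith
  have hX0 : ∀ j, 0 ≤ m j / d (j + 1) := fun j => div_nonneg (hm j) (hd _).le
  have hY0 : ∀ j, 0 ≤ e j / d (j + 1) := fun j => div_nonneg (he j) (hd _).le
  have claim2 : ∀ n, b n / d (n + 1) ≤ C / d 0 + C * (∑ j ∈ Finset.range n, m j / d (j + 1)) +
      C * ∑ j ∈ Finset.range n, e j / d (j + 1) := by
    intro n
    induction n with
    | zero =>
      refine (div_le_div_of_nonneg_right hb0 (hd 1).le).trans_eq ?_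
      have := (hd 0).ne'; have := (hd 1).ne'
      simp only [Finset.sum_range_zero, mul_zero, add_zero]
      field_simp
    | succ n ih =>
      rw [Finset.sum_range_succ, Finset.sum_range_succ]
      have h1 : b (n + 1) / d (n + 2) ≤
          b n / d (n + 1) + C * (m n / d (n + 1)) + C * (e n / d (n + 1)) := by
        refine (div_le_div_of_nonneg_right (hbs n) (hd (n + 2)).le).trans_eq ?_
        have := (hd (n + 1)).ne'; have := (hd (n + 2)).ne'
        field_simp
      rw [show n + 1 + 1 = n + 2 from rfl]
      linarith
  have h1 := claim1 n
  have h2 := claim2 n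
  have hW0 := mul_nonneg (hWpos (n + 1)) (hs0 n)
  have hXn : X n = (∑ j ∈ Finset.range n, m j / d (j + 1)) + m n / d (n + 1) :=
    Finset.sum_range_succ _ _
  have hYn : Y n = (∑ j ∈ Finset.range n, e j / d (j + 1)) + e n / d (n + 1) :=
    Finset.sum_range_succ _ _
  have hX' := Finset.sum_nonneg fun j (_ : j ∈ Finset.range n) => hX0 j
  have hY' : 0 ≤ Y n := Finset.sum_nonneg fun j _ => hY0 j
  have hmX : m n / d (n + 1) ≤ (1 + c) ^ 2 * C * Y n := by linarith
  have hbY : b n / d (n + 1) ≤ C / d 0 + C * ((1 + c) ^ 2 * C * Y n) + C * Y n := by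
    refine h2.trans ?_
    gcongr
    · linarith [hX0 n]
    · linarith [hY0 n]
  have hd0 : 0 ≤ C * (1 + C) * (1 + c) ^ 2 * (1 / d 0) := by
    have := hd 0; positivity
  have hfin : (b n + m n) / d (n + 1) ≤
      (C + C * (1 + C) * (1 + c) ^ 2) * (1 / d 0 + Y n) := by
    rw [add_div]
    have : C / d 0 = C * (1 / d 0) := by ring
    linarith
  rw [div_le_iff₀ (hd (n + 1))] at hfin
  refine hfin.trans_eq ?_
  have : ∑ j ∈ Finset.range (n + 1), d (n + 1) / d (j + 1) * e j = Y n * d (n + 1) := by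
    simp only [hY]
    rw [Finset.sum_mul]
    exact Finset.sum_congr rfl fun j _ => by ring
  rw [this]
  ring

/-! ### The inequality for a lift. -/

namespace IrrationalLift

variable {F : CircleDeg1Lift} {ρ α V : ℝ}

theorem gap_div_gap_le (h : IrrationalLift F ρ α V) {j n : ℕ} (hjn : j ≤ n) (x : ℝ) :
    gap F ρ n x / gap F ρ j x ≤
      (1 + Real.exp (12 * V)) * Real.exp (6 * V) * (maxGap F ρ n / maxGap F ρ j) := by
  rw [← mul_div_assoc, div_le_div_iff₀ (h.gap_pos j x) (h.maxGap_pos j)]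
  exact (h.gap_mul_maxGap_le hjn x).trans_eq (by ring)

/-- The Denjoy-type inequality for a lift. -/
theorem exists_abs_exp_logSlope_sub_one_le (h : IrrationalLift F ρ α V)
    (hα : α ∈ Icc (0 : ℝ) 1) :
    ∃ C, 0 ≤ C ∧ ∀ n x, |Real.exp (logSlope F (q ρ (n + 1)) x x) - 1| ≤
      C * (maxGap F ρ (n + 1) / maxGap F ρ 0 + ∑ j ∈ Finset.range (n + 1),
        maxGap F ρ (n + 1) / maxGap F ρ (j + 1) * maxGap F ρ j ^ α) := by
  have hV := h.bound.nonneg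
  obtain ⟨C1, hC1, hm⟩ := h.exists_devM_succ_le hα
  obtain ⟨C2, hC2, hb⟩ := h.exists_devA_succ_le hα
  have he0 := Real.rpow_pos_of_pos (h.maxGap_pos 0) α
  set B := Real.exp (24 * V) with hB
  have hB1 : 1 ≤ B := Real.one_le_exp (by positivity)
  have hexp : ∀ t, |t| ≤ 24 * V → |Real.exp t - 1| ≤ B := fun t ht => by
    have h1 := Real.exp_le_exp.2 (abs_le.1 ht).2
    have h2 := Real.exp_pos t
    rw [abs_le]
    constructor <;> linarith
  -- The last two entries serve the initial conditions: B for the change of length, B / l_0^α for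
  -- the ratio distortion.
  set C := max (max C1 C2) (max B (B / maxGap F ρ 0 ^ α)) with hC
  have hCC1 : C1 ≤ C := (le_max_left _ _).trans (le_max_left _ _)
  have hCC2 : C2 ≤ C := (le_max_right _ _).trans (le_max_left _ _)
  have hCB : B ≤ C := (le_max_left _ _).trans (le_max_right _ _)
  have hCB' : B / maxGap F ρ 0 ^ α ≤ C := (le_max_right _ _).trans (le_max_right _ _)
  have hC0 : 0 ≤ C := hC1.trans hCC1
  set c := Real.exp (12 * V) with hc
  have hc0 : 0 ≤ c := (Real.exp_pos _).le
  set R := (1 + c) * Real.exp (6 * V) with hR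
  have hR0 : 0 ≤ R := by positivity
  have he : ∀ n, 0 ≤ maxGap F ρ n ^ α := fun n => Real.rpow_nonneg (h.maxGap_pos n).le α
  have hD : ∀ n x, 0 ≤ devM F ρ n x := fun n x => (abs_nonneg _).trans (le_max_left _ _)
  set C' := C + C * (1 + C) * (1 + c) ^ 2 with hC'
  have hC'0 : 0 ≤ C' := by positivity
  refine ⟨B * (C' * R), by positivity, fun n x => ?_⟩
  have key := add_le_of_recursive_le (d := fun n => gap F ρ n x)
    (e := fun n => maxGap F ρ n ^ α) (m := fun n => devM F ρ n x) (b := fun n => devA F ρ n x)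
    hc0 hC0 (fun n => h.gap_pos n x) (fun n => h.gap_succ_le n x) (fun n => h.gap_contract n x) he
    (fun n => hD n x) (by
      refine le_trans ?_ (mul_le_mul_of_nonneg_right hCB' he0.le)
      rw [div_mul_cancel₀ _ he0.ne']
      exact max_le (hexp _ (h.abs_logM_le _ _ _)) (hexp _ (h.abs_logM_le _ _ _)))
    (fun n => (hm n x).trans (by have := he (n + 1); gcongr))
    (by
      have h1 := h.devA_mul_gap 0 x
      rw [← eq_div_iff (h.gap_pos 0 x).ne'] at h1
      rw [h1, mul_div_assoc]
      refine mul_le_mul_of_nonneg_right ?_ (div_pos (h.gap_pos 1 x) (h.gap_pos 0 x)).le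
      refine (hexp _ ((h.abs_logSlope_q_le _ _ _).trans (by linarith))).trans hCB)
    (fun n => (hb n x).trans (by
      have h1 := he n
      have h2 := hD n x
      have h3 := div_pos (h.gap_pos (n + 2) x) (h.gap_pos (n + 1) x)
      gcongr)) n
  have hsum : gap F ρ (n + 1) x / gap F ρ 0 x + ∑ j ∈ Finset.range (n + 1),
      gap F ρ (n + 1) x / gap F ρ (j + 1) x * maxGap F ρ j ^ α ≤
      R * (maxGap F ρ (n + 1) / maxGap F ρ 0 + ∑ j ∈ Finset.range (n + 1),
        maxGap F ρ (n + 1) / maxGap F ρ (j + 1) * maxGap F ρ j ^ α) := by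
    rw [mul_add, Finset.mul_sum]
    refine add_le_add (h.gap_div_gap_le (Nat.zero_le _) x) (Finset.sum_le_sum fun j hj => ?_)
    rw [← mul_assoc]
    refine mul_le_mul_of_nonneg_right (h.gap_div_gap_le ?_ x) (he j)
    rw [Finset.mem_range] at hj
    lia
  set a := logSlope F (q ρ (n + 1)) x (ret F ρ n x) with ha
  have e1 : logSlope F (q ρ (n + 1)) x x = a + logM F ρ n x x := by
    simp only [ha, logM]; ring
  have haB : Real.exp a ≤ B := by
    refine Real.exp_le_exp.2 ?_
    have := (abs_le.1 (h.abs_logSlope_q_le (n + 1) x (ret F ρ n x))).2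
    linarith
  have e2 : |Real.exp (a + logM F ρ n x x) - 1| ≤ B * (devA F ρ n x + devM F ρ n x) := by
    have e3 : Real.exp (a + logM F ρ n x x) - 1 =
        (Real.exp a - 1) + Real.exp a * (Real.exp (logM F ρ n x x) - 1) := by
      rw [Real.exp_add]; ring
    rw [e3]
    refine (abs_add_le _ _).trans ?_
    rw [abs_mul, Real.abs_exp, mul_add]
    exact add_le_add (le_mul_of_one_le_left (abs_nonneg _) hB1)
      (mul_le_mul haB (le_max_left _ _) (abs_nonneg _) (by positivity))
  rw [e1]
  calc _ ≤ _ := e2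
    _ ≤ B * (C' * (R * (maxGap F ρ (n + 1) / maxGap F ρ 0 + ∑ j ∈ Finset.range (n + 1),
        maxGap F ρ (n + 1) / maxGap F ρ (j + 1) * maxGap F ρ j ^ α))) := by
        gcongr
        exact key.trans (mul_le_mul_of_nonneg_left hsum hC'0)
    _ = _ := by ring

end IrrationalLift

/-! ### Descent to the circle. -/

theorem IsLift.iterate {F : CircleDeg1Lift} {f : UnitAddCircle → UnitAddCircle}
    (h : IsLift F f) (m : ℕ) (x : ℝ) :
    ((F^[m] x : ℝ) : UnitAddCircle) = f^[m] (x : UnitAddCircle) := by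
  induction m with
  | zero => rfl
  | succ m ih => rw [Function.iterate_succ_apply', Function.iterate_succ_apply', h.2, ih]

/-- Two lifts of the same map differ by an integer. -/
theorem IsLift.exists_eq_add_int {F G : CircleDeg1Lift} {f : UnitAddCircle → UnitAddCircle}
    (hF : IsLift F f) (hG : IsLift G f) : ∃ k : ℤ, ∀ x, G x = F x + k := by
  have h : ∀ x, ∃ k : ℤ, (k : ℝ) = G x - F x := fun x => by
    have := (hG.2 x).trans (hF.2 x).symm
    rw [← sub_eq_zero, ← AddCircle.coe_sub, AddCircle.coe_eq_zero_iff] at this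
    obtain ⟨k, hk⟩ := this
    exact ⟨k, by simpa using hk⟩
  choose k hk using h
  have hc : Continuous k := by
    rw [Int.isClosedEmbedding_coe_real.isEmbedding.continuous_iff]
    have : (Int.cast ∘ k : ℝ → ℝ) = fun x => G x - F x := funext hk
    rw [this]
    exact hG.1.sub hF.1
  refine ⟨k 0, fun x => ?_⟩
  rw [← PreconnectedSpace.constant inferInstance hc (x := x) (y := 0), hk]
  ring

theorem arcLength_coe {a b : ℝ} (h : b - a ∈ Ico (0 : ℝ) 1) :
    arcLength (a : UnitAddCircle) (b : UnitAddCircle) = b - a := by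
  unfold arcLength
  rw [← AddCircle.coe_sub, AddCircle.equivIco_coe_eq (by simpa using h)]

theorem coe_int_unitAddCircle (k : ℤ) : (((k : ℝ)) : UnitAddCircle) = 0 := by
  rw [AddCircle.coe_eq_zero_iff]
  exact ⟨k, by simp⟩

theorem coe_ret {F : CircleDeg1Lift} {f : UnitAddCircle → UnitAddCircle} (h : IsLift F f)
    (ρ : ℝ) (n : ℕ) (x : ℝ) :
    ((ret F ρ n x : ℝ) : UnitAddCircle) = f^[q ρ n] (x : UnitAddCircle) := by
  rw [ret, AddCircle.coe_sub, coe_int_unitAddCircle, sub_zero, h.iterate]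

theorem segmentLength_coe {F : CircleDeg1Lift} {f : UnitAddCircle → UnitAddCircle} {ρ : ℝ}
    (h : IsLift F f) (hF : F.translationNumber = ρ) (hρ : Irrational ρ) (n : ℕ) (x : ℝ) :
    segmentLength f ρ n (x : UnitAddCircle) = gap F ρ n x := by
  obtain ⟨h1, h2⟩ := gap_eq hF hρ n x
  have h3 := gap_lt_one hF hρ n x
  unfold segmentLength
  rw [← coe_ret h]
  split_ifs with hn
  · rw [hn.neg_one_pow, one_mul] at h1
    rw [arcLength_coe ⟨by linarith, by linarith⟩, h1]
  · rw [(Nat.not_even_iff_odd.1 hn).neg_one_pow] at h1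
    rw [arcLength_coe ⟨by linarith, by linarith⟩, h1]
    ring

theorem l_eq_maxGap {F : CircleDeg1Lift} {f : UnitAddCircle → UnitAddCircle} {ρ : ℝ}
    (h : IsLift F f) (hF : F.translationNumber = ρ) (hρ : Irrational ρ) (n : ℕ) :
    l f ρ n = maxGap F ρ n := by
  unfold l maxGap
  have hs : Function.Surjective ((↑) : ℝ → UnitAddCircle) := QuotientAddGroup.mk_surjective
  rw [← hs.iSup_comp]
  exact iSup_congr fun x => segmentLength_coe h hF hρ n x

/-- By continuity G(x + t) - G(x) stays in (-1/2, 1/2) for small t, where the circle coordinate is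
the real difference itself. -/
theorem hasCircleDerivAt_of_lift {f : UnitAddCircle → UnitAddCircle} {G : ℝ → ℝ} {d x : ℝ}
    (hG : ∀ y : ℝ, ((G y : ℝ) : UnitAddCircle) = f (y : UnitAddCircle)) (hd : HasDerivAt G d x) :
    HasCircleDerivAt f d (x : UnitAddCircle) := by
  have h1 : HasDerivAt (fun t : ℝ => G (x + t) - G x) d 0 := by
    have : HasDerivAt G d (x + 0) := by simpa using hd
    exact (this.comp_const_add x 0).sub_const _
  refine h1.congr_of_eventuallyEq ?_
  have h2 : ∀ᶠ t in 𝓝 (0 : ℝ), G (x + t) - G x ∈ Ioo (-1 / 2 : ℝ) (1 / 2) :=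
    h1.continuousAt.eventually_mem (Ioo_mem_nhds (by simp; norm_num) (by simp))
  filter_upwards [h2] with t ht
  rw [← AddCircle.coe_add, ← hG, ← hG, ← AddCircle.coe_sub,
    AddCircle.equivIco_coe_eq ⟨ht.1.le, by linarith [ht.2]⟩]

theorem exists_irrationalLift {α ρ : ℝ} (hα : α ∈ Icc (0 : ℝ) 1)
    {f : UnitAddCircle → UnitAddCircle} (hf : IsOrientationPreservingDiffeo α f)
    (hρ : IsRotationNumber f ρ) (hirr : Irrational ρ) :
    ∃ (F : CircleDeg1Lift) (V : ℝ), IsLift F f ∧ IrrationalLift F ρ α V := by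
  obtain ⟨F, hF, hF2, hF0, K, hK⟩ := hf
  obtain ⟨G, hG, hGρ⟩ := hρ
  -- The smooth lift and the lift with translation number ρ may differ; they do so by an integer, so
  -- the latter inherits the smoothness.
  obtain ⟨k, hk⟩ := hF.exists_eq_add_int hG
  have hGF : (G : ℝ → ℝ) = fun x => F x + k := funext hk
  have hd : deriv G = deriv F := by
    rw [hGF]; ext x; simp
  have hG2 : ContDiff ℝ 2 G := by rw [hGF]; exact hF2.add contDiff_const
  obtain ⟨V, hV⟩ := exists_distortionBound (F := G) hα hG2 (by rwa [hd]) G.map_add_one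
    (K := K) (by rwa [hd])
  exact ⟨G, V, hG, hG2, by rwa [hd], hirr, hGρ, hV⟩

end CircleDynamics

end

/-- Denjoy-type inequality. -/
theorem mainTheorem2 (α : ℝ) (hα : α ∈ Set.Icc (0 : ℝ) 1)
    (T : UnitAddCircle ≃ₜ UnitAddCircle)
    (hT : CircleDynamics.IsOrientationPreservingDiffeo α T)
    (ρ : ℝ) (hρ : CircleDynamics.IsRotationNumber T ρ) (hirr : Irrational ρ) :
    ∃ C : ℝ, ∀ (n : ℕ) (ξ : UnitAddCircle), ∃ d : ℝ,
      CircleDynamics.HasCircleDerivAt (T^[CircleDynamics.q ρ n]) d ξ ∧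
        |d - 1| ≤ C * CircleDynamics.ε α T ρ n := by
  obtain ⟨F, V, hF, h⟩ := CircleDynamics.exists_irrationalLift hα hT hρ hirr
  obtain ⟨C, hC, hCb⟩ := h.exists_abs_exp_logSlope_sub_one_le hα
  have hl := CircleDynamics.l_eq_maxGap hF h.translationNumber_eq hirr
  -- The second entry covers n = 0, where ε_0 = 1 and Denjoy's inequality is enough.
  refine ⟨max C (Real.exp (12 * V)), fun n ξ => ?_⟩
  obtain ⟨x, rfl⟩ := QuotientAddGroup.mk_surjective ξ
  refine ⟨Real.exp (CircleDynamics.logSlope F (CircleDynamics.q ρ n) x x),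
    CircleDynamics.hasCircleDerivAt_of_lift (hF.iterate _)
      (CircleDynamics.hasDerivAt_iterate h.contDiff h.deriv_pos _ x), ?_⟩
  cases n with
  | zero =>
    have h1 := Real.exp_le_exp.2 (abs_le.1 (h.abs_logSlope_q_le 0 x x)).2
    have h2 := Real.exp_pos (CircleDynamics.logSlope F (CircleDynamics.q ρ 0) x x)
    have hV := h.bound.nonneg
    have h3 : 1 ≤ Real.exp (12 * V) := Real.one_le_exp (by positivity)
    have h4 := le_max_right C (Real.exp (12 * V))
    simp only [CircleDynamics.ε, CircleDynamics.lPrev, Real.one_rpow, Finset.range_zero,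
      Finset.sum_empty, add_zero, mul_one]
    rw [abs_le]
    constructor <;> linarith
  | succ n =>
    -- Reindexing: the term j = 0 uses l_{-1} = 1, and the leading l_n^α becomes the last summand,
    -- with quotient l_{n+1}/l_{n+1} = 1.
    have e : CircleDynamics.ε α T ρ (n + 1) = CircleDynamics.maxGap F ρ (n + 1) /
        CircleDynamics.maxGap F ρ 0 + ∑ j ∈ Finset.range (n + 1),
        CircleDynamics.maxGap F ρ (n + 1) / CircleDynamics.maxGap F ρ (j + 1) *
          CircleDynamics.maxGap F ρ j ^ α := by
      unfold CircleDynamics.ε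
      rw [Finset.sum_range_succ', Finset.sum_range_succ]
      simp only [CircleDynamics.lPrev, hl, Real.one_rpow, mul_one,
        div_self (h.maxGap_pos (n + 1)).ne', one_mul]
      ring
    rw [e]
    refine (hCb n x).trans (mul_le_mul_of_nonneg_right (le_max_left _ _) ?_)
    refine add_nonneg (div_pos (h.maxGap_pos _) (h.maxGap_pos _)).le
      (Finset.sum_nonneg fun j _ => mul_nonneg (div_pos (h.maxGap_pos _) (h.maxGap_pos _)).le
        (Real.rpow_nonneg (h.maxGap_pos _).le _))
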